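/- For a nonnegative integer $m$ let $[m]_q=1+q+\cdots+q^{m-1}=(1-q^m)/(1-q)$ and $[m]=[m]_q$; let $(a;q)_k=(1-a)(1-aq)\cdots(1-aq^{k-1})$, and let $\Phi_n(q)$ be the $n$-th cyclotomic polynomial. For rational functions $A,B\in\mathbb{Q}(q)$ and a polynomial $P\in\mathbb{Q}[q]$, $A\equiv B\pmod P$ means that the numerator of $A-B$, written in lowest terms, is divisible by $P$. Put \[B(n,q)=\frac{(n^2-1)(1-q)^2}{24}+\sum_{k=1}^{(n-1)/4}\frac{q^{4k-2}}{[4k-2]_q^2}.\] Let $n\equiv 1\pmod 4$ be a positive integer and let $M=(n-1)/4$ or $M=n-1$. Then, modulo $[n]\Phi_n(q)^3$, \[\sum_{k=0}^{M}[8k+1]\frac{(q;q^4)_k^4}{(q^4;q^4)_k^4}q^{2k}\equiv\frac{(q^2;q^4)_{(n-1)/4}}{(q^4;q^4)_{(n-1)/4}}[n]\,q^{(1-n)/4}\bigl\{1+[n]^2B(n,q)\bigr\},\] and, if $n>1$, also modulo $[n]\Phi_n(q)^3$, \[\sum_{k=0}^{M}[8k+1]_{q^2}[8k+1]^2\frac{(q^2;q^8)_k^4}{(q^8;q^8)_k^4}q^{-4k}\equiv-\frac{2[n]_{q^2}(q^4;q^8)_{(n-1)/4}}{(1+q^2)(q^8;q^8)_{(n-1)/4}}\,q^{(3-n)/2}\bigl\{1+[n]_{q^2}^2B(n,q^2)\bigr\}.\]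 -/

import Mathlib

open Polynomial

/-- The `q`-integer `[n]_q = 1 + q + ⋯ + q^(n-1)`, which is `(1 - q^n) / (1 - q)` when the latter
makes sense (see `qInt_eq_div`). It is used both for polynomials and for rational functions. -/
def qInt {R : Type*} [CommRing R] (q : R) (n : ℕ) : R :=
  ∑ i ∈ Finset.range n, q ^ i

theorem qInt_eq_div {K : Type*} [Field K] (q : K) (hq : q ≠ 1) (n : ℕ) :
    qInt q n = (1 - q ^ n) / (1 - q) := by
  have h : (1 : K) - q ≠ 0 := sub_ne_zero.mpr hq.symm
  rw [eq_div_iff h, qInt, geom_sum_mul_neg]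

/-- The `q`-shifted factorial `(a; q)_k = (1 - a) (1 - a q) ⋯ (1 - a q^(k-1))`. -/
def qShift {R : Type*} [CommRing R] (a q : R) (k : ℕ) : R :=
  ∏ i ∈ Finset.range k, (1 - a * q ^ i)

/-- `B(n, q) = (n² - 1) (1 - q)² / 24 + ∑_{k = 1}^{(n-1)/4} q^(4k-2) / [4k-2]²`. -/
noncomputable def qB {K : Type*} [Field K] (n : ℕ) (q : K) : K :=
  ((n : K) ^ 2 - 1) * (1 - q) ^ 2 / 24
    + ∑ k ∈ Finset.Icc 1 ((n - 1) / 4), q ^ (4 * k - 2) / qInt q (4 * k - 2) ^ 2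

/-- Congruence of rational functions in `q` modulo a polynomial `P`: the numerator of `A - B`,
written in lowest terms, is divisible by `P` (so the denominator is coprime to `P`). -/
def QCong (P : ℚ[X]) (A B : RatFunc ℚ) : Prop :=
  P ∣ (A - B).num

/-- The modulus `[n] Φ_n(q)³`, as a polynomial in `q`. -/
noncomputable def qModulus (n : ℕ) : ℚ[X] :=
  qInt (X : ℚ[X]) n * cyclotomic n ℚ ^ 3

/-! Let n = 4N + 1, let Q be q or q², and put x = Q^(-n), u = x - 1, v = u³; then u vanishes at the
primitive n-th roots of unity. In the fourth power of (Q;Q⁴)_k replace three factors by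
(Q(1+ωu);Q⁴)_k, with ω running over the cube roots of unity, and deform the denominator to match.
The result depends on u only through v (`deformedProd`). On the other hand ω = 1 gives Qx = Q^(-4N),
so the deformed series is a terminating very-well-poised ₆φ₅ and has an exact product (`vwpSum_eq`,
`sum_deformed_eq`).

Modulo Φ_n⁴ the deformation is invisible: the expansion in v has an error of order v², and at a root
of unity the terms of the coefficient of v are antisymmetric under k ↦ N - k, which gains the
missing order (`sum_deformed_sub`). The product carries a factor 1 - Q^n, so its cofactor is needed
to order three only. There it is 1 plus a second-order term, which the evaluation of ∑ z^j/(1-z^j)²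
at roots of unity turns into [n]²B (`prod_closed_form_approx`).

For the second congruence take Q = q²; then (1-q^(8k+1))² q^(-4k) = Q^(2k) (Q^(-4k) + Q^(4k+1) -
2q). The weight Q^(-4k) + Q^(4k+1) is symmetric under the reflection, and it turns the ₆φ₅ into a
combination of two consecutive ones, hence into a multiple of itself (`sum_deformed_weighted`).

At roots of unity of order d, for the other divisors d > 1 of n, only simple vanishing is required.
The sum splits into blocks of length d, each killed by the same antisymmetry (`vanishesTo_sum`), and
the right side vanishes as well (`vanishesTo_closed_form`). The local statements are glued by
`qCong_of_vanishesTo`. -/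

/-! ### The terminating very-well-poised ₆φ₅ summation. -/

/-- The part of the `k`-th term of the terminating very-well-poised series `₆φ₅` with base `p` which
involves the terminating parameter `1 / X`. -/
def vwpMoving {K : Type*} [Field K] (a p X : K) (k : ℕ) : K :=
  ∏ i ∈ Finset.range k, ((X - p ^ i) / (1 - a * X * p * p ^ i))

/-- The part of the `k`-th term of the very-well-poised series `₆φ₅` with base `p` which involves
`a` and two further parameters, given by their sum `s` and product `m`. -/
def vwpFixed {K : Type*} [Field K] (a p s m : K) (k : ℕ) : K :=
  ∏ i ∈ Finset.range k, (a * p * (1 - a * p ^ i) * (1 - s * p ^ i + m * (p ^ i) ^ 2)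
    / ((1 - p * p ^ i) * (m - s * a * p * p ^ i + a ^ 2 * p ^ 2 * (p ^ i) ^ 2)))

theorem vwpMoving_succ {K : Type*} [Field K] (a p X : K) (k : ℕ) :
    vwpMoving a p X (k + 1) = vwpMoving a p X k * ((X - p ^ k) / (1 - a * X * p * p ^ k)) :=
  Finset.prod_range_succ _ _

theorem vwpFixed_succ {K : Type*} [Field K] (a p s m : K) (k : ℕ) :
    vwpFixed a p s m (k + 1) = vwpFixed a p s m k *
      (a * p * (1 - a * p ^ k) * (1 - s * p ^ k + m * (p ^ k) ^ 2)
    / ((1 - p * p ^ k) * (m - s * a * p * p ^ k + a ^ 2 * p ^ 2 * (p ^ k) ^ 2))) :=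
  Finset.prod_range_succ _ _

/-- Since pX - p^(i+1) = p(X - p^i), replacing X by pX shifts the index of both numerator and
denominator, and all but the end factors cancel. -/
theorem vwpMoving_shift {K : Type*} [Field K] (a p X : K) (k : ℕ)
    (h1 : ∀ i ≤ k + 1, 1 - a * X * p * p ^ i ≠ 0) :
    vwpMoving a p (p * X) (k + 1) = vwpMoving a p X k *
      ((p * X - 1) * p ^ k * (1 - a * X * p)
        / ((1 - a * X * p * p ^ k) * (1 - a * X * p * p ^ (k + 1)))) := by
  induction k with
  | zero =>
    have e1 := h1 0 (by omega)
    have e2 := h1 1 (by omega)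
    simp only [vwpMoving, Finset.prod_range_one, Finset.prod_range_zero, pow_zero, mul_one,
      pow_one, zero_add, one_mul] at *
    have e5 : 1 - a * (p * X) * p ≠ 0 := by convert e2 using 1; ring
    rw [div_eq_div_iff e5 (mul_ne_zero e1 e2)]
    ring
  | succ k ih =>
    rw [vwpMoving_succ, ih (fun i hi => h1 i (by omega)), vwpMoving_succ]
    have e0 := h1 k (by omega)
    have e1 := h1 (k + 1) (by omega)
    have e2 := h1 (k + 2) (by omega)
    have e5 : 1 - a * (p * X) * p * p ^ (k + 1) ≠ 0 := by convert e2 using 1; ring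
    rw [mul_assoc, mul_assoc (vwpMoving a p X k) ((X - p ^ k) / _)]
    congr 1
    rw [div_mul_div_comm, div_mul_div_comm, div_eq_div_iff]
    · ring
    · exact mul_ne_zero (mul_ne_zero e0 e1) e5
    · exact mul_ne_zero e0 (mul_ne_zero e1 e2)

/-- A Wilf–Zeilberger certificate: the right side is the partial sum of the contiguous relation
between the parameters X and pX, so induction on `k` reduces the claim to one rational identity. -/
theorem vwp_telescope {K : Type*} [Field K] (a p s m X : K) (k : ℕ)
    (h1 : ∀ i ≤ k + 1, 1 - a * X * p * p ^ i ≠ 0) (h2 : ∀ i < k, 1 - p * p ^ i ≠ 0)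
    (h3 : ∀ i < k, m - s * a * p * p ^ i + a ^ 2 * p ^ 2 * (p ^ i) ^ 2 ≠ 0) :
    ∑ j ∈ Finset.range (k + 1), (1 - a * (p ^ j) ^ 2) * vwpFixed a p s m j *
      ((m - s * a * p * X + a ^ 2 * p ^ 2 * X ^ 2) * vwpMoving a p (p * X) j
        - (1 - a * p * X) * (m - a * p * X) * vwpMoving a p X j)
      = X * (1 - a * X * p) * (a * p) * (1 - a * p ^ k) * (1 - s * p ^ k + m * (p ^ k) ^ 2)
        / (1 - a * X * p * p ^ k) * vwpFixed a p s m k * vwpMoving a p X k := by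
  induction k with
  | zero =>
    have e1 := h1 0 (by omega)
    simp only [Finset.sum_range_one, vwpMoving, vwpFixed, Finset.prod_range_zero, zero_add,
      pow_zero, mul_one, one_pow] at *
    rw [eq_div_iff e1]
    ring
  | succ k ih =>
    rw [Finset.sum_range_succ, ih (fun i hi => h1 i (by omega)) (fun i hi => h2 i (by omega))
      (fun i hi => h3 i (by omega)), vwpMoving_shift a p X k (fun i hi => h1 i (by omega)),
      vwpFixed_succ, vwpMoving_succ]
    have e0 := h1 k (by omega)
    have e1 := h1 (k + 1) (by omega)
    have e3 := h2 k (by omega)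
    have e4 := h3 k (by omega)
    simp only [pow_succ p k] at *
    generalize p ^ k = y at *
    generalize vwpMoving a p X k = V
    generalize vwpFixed a p s m k = W
    obtain ⟨b, hb⟩ : ∃ b, b = m - s * a * p * y + a ^ 2 * p ^ 2 * y ^ 2 := ⟨_, rfl⟩
    obtain ⟨c, hc⟩ : ∃ c, c = 1 - a * X * p * y := ⟨_, rfl⟩
    obtain ⟨d, hd⟩ : ∃ d, d = 1 - a * X * p * (y * p) := ⟨_, rfl⟩
    obtain ⟨e, he⟩ : ∃ e, e = 1 - p * y := ⟨_, rfl⟩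
    rw [← hb] at e4 ⊢
    rw [← hc] at e0 ⊢
    rw [← hd] at e1 ⊢
    rw [← he] at e3 ⊢
    clear ih h1 h2 h3
    field_simp
    simp only [hb, hd, he]
    ring

/-- The sum of the terminating very-well-poised series. -/
noncomputable def vwpSum {K : Type*} [Field K] (a p s m : K) (N : ℕ) : K :=
  ∑ k ∈ Finset.range (N + 1),
    (1 - a * (p ^ k) ^ 2) * vwpFixed a p s m k * vwpMoving a p (p ^ N) k

theorem vwpMoving_eq_zero {K : Type*} [Field K] (a p : K) {N k : ℕ} (h : N < k) :
    vwpMoving a p (p ^ N) k = 0 :=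
  Finset.prod_eq_zero (Finset.mem_range.mpr h) (by simp)

theorem vwpSum_eq_sum_succ {K : Type*} [Field K] (a p s m : K) (N : ℕ) :
    vwpSum a p s m N = ∑ k ∈ Finset.range (N + 1 + 1),
      (1 - a * (p ^ k) ^ 2) * vwpFixed a p s m k * vwpMoving a p (p ^ N) k := by
  rw [Finset.sum_range_succ, vwpMoving_eq_zero _ _ (Nat.lt_succ_self N), mul_zero, add_zero,
    vwpSum]

theorem vwpSum_succ {K : Type*} [Field K] (a p s m : K) (N : ℕ)
    (h1 : ∀ i, 1 - a * p ^ (i + 1) ≠ 0) (h2 : ∀ i, 1 - p ^ (i + 1) ≠ 0)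
    (h3 : ∀ i ≤ N, m - s * a * p * p ^ i + a ^ 2 * p ^ 2 * (p ^ i) ^ 2 ≠ 0) :
    (m - s * a * p * p ^ N + a ^ 2 * p ^ 2 * (p ^ N) ^ 2) * vwpSum a p s m (N + 1)
      = (1 - a * p * p ^ N) * (m - a * p * p ^ N) * vwpSum a p s m N := by
  have h := vwp_telescope a p s m (p ^ N) (N + 1)
    (fun i _ => by have := h1 (N + i); convert this using 1; ring)
    (fun i _ => by have := h2 i; convert this using 1; ring) (fun i hi => h3 i (by omega))
  -- With X = p^N and one term beyond the end of the shorter sum, the boundary term of the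
  -- telescoping is zero.
  rw [vwpMoving_eq_zero _ _ (Nat.lt_succ_self N), mul_zero] at h
  rw [vwpSum_eq_sum_succ a p s m N, vwpSum, Finset.mul_sum, Finset.mul_sum, ← sub_eq_zero,
    ← Finset.sum_sub_distrib, ← h]
  refine Finset.sum_congr rfl fun k _ => ?_
  rw [pow_succ' p N]
  ring

theorem vwpSum_eq {K : Type*} [Field K] (a p s m : K) (N : ℕ)
    (h1 : ∀ i, 1 - a * p ^ (i + 1) ≠ 0) (h2 : ∀ i, 1 - p ^ (i + 1) ≠ 0)
    (h3 : ∀ i < N, m - s * a * p * p ^ i + a ^ 2 * p ^ 2 * (p ^ i) ^ 2 ≠ 0) :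
    vwpSum a p s m N = (1 - a) * ∏ i ∈ Finset.range N, ((1 - a * p * p ^ i) * (m - a * p * p ^ i)
      / (m - s * a * p * p ^ i + a ^ 2 * p ^ 2 * (p ^ i) ^ 2)) := by
  induction N with
  | zero => simp [vwpSum, vwpFixed, vwpMoving]
  | succ N ih =>
    have h := vwpSum_succ a p s m N h1 h2 (fun i hi => h3 i (by omega))
    have h4 := h3 N (by omega)
    rw [ih fun i hi => h3 i (by omega)] at h
    rw [Finset.prod_range_succ, ← mul_assoc, mul_div_assoc', eq_div_iff h4, mul_comm, h]
    ring

/-- With X = p^(N+1) and y = p^k one has (X - y)(1 - aXy) = Xy((y⁻¹ + ay) - (X⁻¹ + aX)). Multiplying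
by this factor lowers N + 1 to N, so the weight y⁻¹ + ay is expressible through the sums for N + 1
and N. -/
theorem vwpMoving_pow_succ {K : Type*} [Field K] (a p : K) (N k : ℕ)
    (h1 : ∀ i, 1 - a * p ^ (i + 1) ≠ 0) :
    vwpMoving a p (p ^ (N + 1)) k * ((p ^ (N + 1) - p ^ k) * (1 - a * p ^ k * p ^ (N + 1)))
      = p ^ k * ((p ^ (N + 1) - 1) * (1 - a * p ^ (N + 1)) * vwpMoving a p (p ^ N) k) := by
  induction k with
  | zero => simp [vwpMoving]
  | succ k ih =>
    rw [vwpMoving_succ, vwpMoving_succ]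
    have e1 : 1 - a * p ^ (N + 1) * p * p ^ k ≠ 0 := by
      have := h1 (N + 1 + k); convert this using 1; ring
    have e2 : 1 - a * p ^ N * p * p ^ k ≠ 0 := by
      have := h1 (N + k); convert this using 1; ring
    have e3 : vwpMoving a p (p ^ (N + 1)) k * (p ^ (N + 1) - p ^ k)
      = p ^ k * ((p ^ (N + 1) - 1) * (1 - a * p ^ (N + 1)) * vwpMoving a p (p ^ N) k)
        / (1 - a * p ^ N * p * p ^ k) := by
      rw [eq_div_iff e2, ← ih, pow_succ p N]; ring
    calc _ = (vwpMoving a p (p ^ (N + 1)) k * (p ^ (N + 1) - p ^ k)) * (p * (p ^ N - p ^ k))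
          * ((1 - a * p ^ (N + 1) * p * p ^ k) / (1 - a * p ^ (N + 1) * p * p ^ k)) := by
            rw [show (1 - a * p ^ (k + 1) * p ^ (N + 1)) = 1 - a * p ^ (N + 1) * p * p ^ k by ring]
            simp only [div_eq_mul_inv]
            ring
      _ = _ := by
            rw [e3, div_self e1]
            simp only [div_eq_mul_inv]
            ring

/-- Inserting the factor `p^(-k) + a p^k` into a terminating very-well-poised series. -/
theorem vwpSum_weighted {K : Type*} [Field K] (a p s m : K) (N : ℕ) (hp : p ≠ 0)
    (h1 : ∀ i, 1 - a * p ^ (i + 1) ≠ 0) :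
    ∑ k ∈ Finset.range (N + 1 + 1), (1 - a * (p ^ k) ^ 2) * vwpFixed a p s m k
        * vwpMoving a p (p ^ (N + 1)) k * ((p ^ k)⁻¹ + a * p ^ k)
      = ((p ^ (N + 1))⁻¹ + a * p ^ (N + 1)) * vwpSum a p s m (N + 1)
        + (1 - (p ^ (N + 1))⁻¹) * (1 - a * p ^ (N + 1)) * vwpSum a p s m N := by
  rw [vwpSum_eq_sum_succ a p s m N, vwpSum, Finset.mul_sum, Finset.mul_sum,
    ← Finset.sum_add_distrib]
  refine Finset.sum_congr rfl fun k _ => ?_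
  have := vwpMoving_pow_succ a p N k h1
  have hk : p ^ k ≠ 0 := pow_ne_zero _ hp
  have hN : p ^ (N + 1) ≠ 0 := pow_ne_zero _ hp
  generalize vwpMoving a p (p ^ (N + 1)) k = V at *
  generalize vwpMoving a p (p ^ N) k = V' at *
  generalize vwpFixed a p s m k = W at *
  generalize p ^ (N + 1) = X at *
  generalize p ^ k = y at *
  field_simp
  linear_combination W * (1 - a * y ^ 2) * this

/-! ### The deformation by cube roots of unity and its exact sums. -/

/-- A one-parameter deformation of `((Q;Q⁴)_k / (Q⁴;Q⁴)_k)⁴`, which is the case `v = 0`. -/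
def deformedProd {K : Type*} [Field K] (Q v : K) (k : ℕ) : K :=
  ∏ i ∈ Finset.range k, ((1 - Q ^ (4 * i + 1))
      * ((1 - Q ^ (4 * i + 1)) ^ 3 - (Q ^ (4 * i + 1)) ^ 3 * v)
    / ((1 - Q ^ (4 * i + 4)) * ((1 - Q ^ (4 * i + 4)) ^ 3 + v)))

/-- With A = Q^(4i+1), the cubic (1-A)³ - A³(x-1)³ factors as the product of 1 - A(1+ω(x-1)) over ω³
= 1. The root ω = 1 is the terminating parameter; the other two parameters have sum Q(3-x) and
product Q²(x²-3x+3). -/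
theorem deformedProd_eq_vwp {K : Type*} [Field K] (Q x : K) (N k : ℕ) (hQ0 : Q ≠ 0)
    (hx : x * Q ^ (4 * N + 1) = 1) (hQ : ∀ j, 0 < j → Q ^ j ≠ 1) :
    Q ^ (2 * k) * deformedProd Q ((x - 1) ^ 3) k
      = vwpFixed Q (Q ^ 4) (Q * (3 - x)) (Q ^ 2 * (x ^ 2 - 3 * x + 3)) k
        * vwpMoving Q (Q ^ 4) ((Q ^ 4) ^ N) k := by
  rw [pow_mul, deformedProd, vwpFixed, vwpMoving, ← Finset.prod_mul_distrib,
    ← Finset.card_range k, ← Finset.prod_const, Finset.card_range, ← Finset.prod_mul_distrib]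
  refine Finset.prod_congr rfl fun i _ => ?_
  have hx0 : x ≠ 0 := left_ne_zero_of_mul_eq_one hx
  have hX : (Q ^ 4) ^ N = 1 / (x * Q) := by
    rw [eq_div_iff (mul_ne_zero hx0 hQ0), ← hx]; ring
  have hB : x - Q ^ 4 * (Q ^ 4) ^ i ≠ 0 := by
    intro h
    apply hQ (4 + 4 * i + (4 * N + 1)) (by omega)
    rw [← hx, sub_eq_zero.mp h]; ring
  rw [hX, pow_add Q (4 * i) 1, pow_add Q (4 * i) 4, pow_mul, pow_one]
  generalize (Q ^ 4) ^ i = y at *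
  have e1 : 1 - Q * (1 / (x * Q)) * Q ^ 4 * y = (x - Q ^ 4 * y) / x := by
    field_simp
  have e2 : 1 / (x * Q) - y = (1 - x * (y * Q)) / (x * Q) := by
    field_simp
  rw [e1, e2]
  have e3 : ((1 - y * Q) ^ 3 - (y * Q) ^ 3 * (x - 1) ^ 3)
      = (1 - x * (y * Q)) * (1 - Q * (3 - x) * y + Q ^ 2 * (x ^ 2 - 3 * x + 3) * y ^ 2) := by ring
  have e4 : Q ^ 2 * ((1 - y * Q ^ 4) ^ 3 + (x - 1) ^ 3) = (x - Q ^ 4 * y) *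
    (Q ^ 2 * (x ^ 2 - 3 * x + 3) - Q * (3 - x) * Q * Q ^ 4 * y + Q ^ 2 * (Q ^ 4) ^ 2 * y ^ 2) := by
    ring
  have e5 : ((1 - y * Q ^ 4) ^ 3 + (x - 1) ^ 3) = (x - Q ^ 4 * y) *
    (Q ^ 2 * (x ^ 2 - 3 * x + 3) - Q * (3 - x) * Q * Q ^ 4 * y + Q ^ 2 * (Q ^ 4) ^ 2 * y ^ 2)
      / Q ^ 2 := by
    rw [← e4]; field_simp
  rw [e3, e5, mul_comm y (Q ^ 4)]
  generalize (Q ^ 2 * (x ^ 2 - 3 * x + 3) - Q * (3 - x) * Q * Q ^ 4 * y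
    + Q ^ 2 * (Q ^ 4) ^ 2 * y ^ 2) = b at *
  generalize 1 - Q * (3 - x) * y + Q ^ 2 * (x ^ 2 - 3 * x + 3) * y ^ 2 = c at *
  generalize x - Q ^ 4 * y = d at *
  generalize 1 - x * (y * Q) = e at *
  generalize 1 - Q ^ 4 * y = f at *
  -- If one of the remaining denominators is zero, both sides are zero because division by zero
  -- gives zero.
  rcases eq_or_ne b 0 with rfl | hb
  · simp
  rcases eq_or_ne f 0 with rfl | hf
  · simp
  rw [mul_comm y Q]
  generalize 1 - Q * y = g at *
  field_simp

theorem sum_deformed_eq_vwpSum {K : Type*} [Field K] (Q x : K) (N : ℕ) (hQ0 : Q ≠ 0)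
    (hx : x * Q ^ (4 * N + 1) = 1) (hQ : ∀ j, 0 < j → Q ^ j ≠ 1) :
    ∑ k ∈ Finset.range (N + 1),
        (1 - Q ^ (8 * k + 1)) * Q ^ (2 * k) * deformedProd Q ((x - 1) ^ 3) k
      = vwpSum Q (Q ^ 4) (Q * (3 - x)) (Q ^ 2 * (x ^ 2 - 3 * x + 3)) N := by
  refine Finset.sum_congr rfl fun k _ => ?_
  rw [mul_assoc, deformedProd_eq_vwp Q x N k hQ0 hx hQ]
  ring

theorem vwp_denom_eq {K : Type*} [Field K] (Q x : K) (N i : ℕ)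
    (hx : x * Q ^ (4 * N + 1) = 1) (hQ : ∀ j, 0 < j → Q ^ j ≠ 1) :
    Q ^ 2 * (x ^ 2 - 3 * x + 3) - Q * (3 - x) * Q * Q ^ 4 * (Q ^ 4) ^ i
        + Q ^ 2 * (Q ^ 4) ^ 2 * ((Q ^ 4) ^ i) ^ 2
      = Q ^ 2 * ((1 - Q ^ (4 * i + 4)) ^ 3 + (x - 1) ^ 3) / (x - Q ^ (4 * i + 4)) := by
  have hB : x - Q ^ (4 * i + 4) ≠ 0 := by
    intro h
    apply hQ (4 * i + 4 + (4 * N + 1)) (by omega)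
    rw [← hx, sub_eq_zero.mp h]; ring
  rw [eq_div_iff hB]
  ring

theorem sum_deformed_eq {K : Type*} [Field K] (Q x : K) (N : ℕ) (hQ0 : Q ≠ 0)
    (hx : x * Q ^ (4 * N + 1) = 1) (hQ : ∀ j, 0 < j → Q ^ j ≠ 1)
    (hv : ∀ i < N, (1 - Q ^ (4 * i + 4)) ^ 3 + (x - 1) ^ 3 ≠ 0) :
    ∑ k ∈ Finset.range (N + 1),
        (1 - Q ^ (8 * k + 1)) * Q ^ (2 * k) * deformedProd Q ((x - 1) ^ 3) k
      = (1 - Q ^ (4 * N + 1)) * ∏ i ∈ Finset.range N,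
        ((1 - x * Q ^ (4 * i + 4)) * (x - Q ^ (4 * i + 4))
            * (1 - Q ^ (4 * i + 2) * (1 + (x - 1) ^ 3))
          / (x ^ 2 * Q ^ (4 * i + 4) * Q ^ (4 * i + 2)
            * ((1 - Q ^ (4 * i + 4)) ^ 3 + (x - 1) ^ 3))) := by
  have hx0 : x ≠ 0 := left_ne_zero_of_mul_eq_one hx
  have hB : ∀ i, x - Q ^ (4 * i + 4) ≠ 0 := by
    intro i h
    apply hQ (4 * i + 4 + (4 * N + 1)) (by omega)
    rw [← hx, sub_eq_zero.mp h]; ring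
  rw [sum_deformed_eq_vwpSum Q x N hQ0 hx hQ, vwpSum_eq]
  · rw [Finset.prod_div_distrib, Finset.prod_mul_distrib]
    -- Shifting the product by one index brings out the factor 1 - Q^n on which the order count
    -- rests.
    have h1 : (1 - Q) * ∏ i ∈ Finset.range N, (1 - Q * Q ^ 4 * (Q ^ 4) ^ i)
        = (1 - Q ^ (4 * N + 1)) * ∏ i ∈ Finset.range N, (1 - Q ^ (4 * i + 1)) := by
      have := Finset.prod_range_succ (fun i => 1 - Q ^ (4 * i + 1)) N
      rw [Finset.prod_range_succ'] at this
      rw [mul_comm (1 - Q ^ (4 * N + 1)), ← this, mul_comm]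
      simp only [mul_zero, zero_add, pow_one]
      congr 1
      refine Finset.prod_congr rfl fun i _ => ?_
      ring
    rw [mul_div_assoc', ← mul_assoc, h1, mul_assoc, mul_div_assoc]
    congr 1
    -- Reversing the two numerator products and using xQ^(4N+1) = 1 turns their factors into 1 -
    -- 1/(xQ^(4i+4)) and an expression in Q^(4i+2), which match the denominators index by index.
    rw [← Finset.prod_range_reflect (fun i => 1 - Q ^ (4 * i + 1)),
      ← Finset.prod_range_reflect
        (fun i => Q ^ 2 * (x ^ 2 - 3 * x + 3) - Q * Q ^ 4 * (Q ^ 4) ^ i),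
      ← Finset.prod_mul_distrib, ← Finset.prod_div_distrib]
    refine Finset.prod_congr rfl fun i hi => ?_
    have hi' := Finset.mem_range.mp hi
    rw [vwp_denom_eq Q x N i hx hQ]
    have e1 : Q ^ (4 * (N - 1 - i) + 1) = 1 / (x * Q ^ (4 * i + 4)) := by
      rw [eq_div_iff (mul_ne_zero hx0 (pow_ne_zero _ hQ0)), ← hx, mul_left_comm, ← pow_add]
      congr 2; omega
    have e2 : Q * Q ^ 4 * (Q ^ 4) ^ (N - 1 - i) = Q ^ 2 / (x * Q ^ (4 * i + 2)) := by
      have : Q * Q ^ 4 * (Q ^ 4) ^ (N - 1 - i) = Q ^ 4 * Q ^ (4 * (N - 1 - i) + 1) := by ring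
      rw [this, e1, pow_add _ _ 4, pow_add _ _ 2]
      field_simp
      ring
    rw [e1, e2]
    have h2 := hv i hi'
    have h3 := hB i
    have e3 : (x ^ 2 - 3 * x + 3) = (1 + (x - 1) ^ 3) / x := by
      rw [eq_div_iff hx0]; ring
    rw [e3]
    have hP : Q ^ (4 * i + 4) ≠ 0 := pow_ne_zero _ hQ0
    have hD : Q ^ (4 * i + 2) ≠ 0 := pow_ne_zero _ hQ0
    generalize Q ^ (4 * i + 4) = B at *
    generalize Q ^ (4 * i + 2) = D at *
    generalize (x - 1) ^ 3 = v at *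
    generalize (1 - B) ^ 3 + v = w at *
    field_simp
    ring
  · intro i
    rw [sub_ne_zero, ← pow_mul, ← pow_succ']
    exact (hQ _ (by omega)).symm
  · intro i
    rw [sub_ne_zero, ← pow_mul]
    exact (hQ _ (by omega)).symm
  · intro i hi
    rw [vwp_denom_eq Q x N i hx hQ]
    exact div_ne_zero (mul_ne_zero (pow_ne_zero _ hQ0) (hv i hi)) (hB i)

/-- The weighted series is a combination of the sums for N and N - 1 by `vwpSum_weighted`;
eliminating the latter with `vwpSum_succ` leaves a multiple of the former. At v = 0 the multiplier
is 4Q/(1+Q). -/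
theorem sum_deformed_weighted {K : Type*} [Field K] (Q x : K) (N : ℕ) (hQ0 : Q ≠ 0) (hN : 0 < N)
    (hx : x * Q ^ (4 * N + 1) = 1) (hQ : ∀ j, 0 < j → Q ^ j ≠ 1)
    (hv : ∀ i < N, (1 - Q ^ (4 * i + 4)) ^ 3 + (x - 1) ^ 3 ≠ 0) :
    (∑ k ∈ Finset.range (N + 1),
        (1 - Q ^ (8 * k + 1)) * Q ^ (2 * k) * deformedProd Q ((x - 1) ^ 3) k
          * ((Q ^ (4 * k))⁻¹ + Q ^ (4 * k + 1))) * (Q ^ 2 * (1 + (x - 1) ^ 3) - 1)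
      = (-4 * Q + 4 * Q ^ 2 + Q ^ 2 * (x - 1) ^ 3) * ∑ k ∈ Finset.range (N + 1),
        (1 - Q ^ (8 * k + 1)) * Q ^ (2 * k) * deformedProd Q ((x - 1) ^ 3) k := by
  obtain ⟨N, rfl⟩ : ∃ N', N = N' + 1 := ⟨N - 1, by omega⟩
  have hx0 : x ≠ 0 := left_ne_zero_of_mul_eq_one hx
  have h1 : ∀ i, 1 - Q * (Q ^ 4) ^ (i + 1) ≠ 0 := by
    intro i
    rw [sub_ne_zero, ← pow_mul, ← pow_succ']
    exact (hQ _ (by omega)).symm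
  have hS := vwpSum_succ Q (Q ^ 4) (Q * (3 - x)) (Q ^ 2 * (x ^ 2 - 3 * x + 3)) N h1
    (fun i => by
      rw [sub_ne_zero, ← pow_mul]
      exact (hQ _ (by omega)).symm)
    (fun i hi => by
      rw [vwp_denom_eq Q x (N + 1) i hx hQ]
      refine div_ne_zero (mul_ne_zero (pow_ne_zero _ hQ0) (hv i (by omega))) fun h => ?_
      apply hQ (4 * i + 4 + (4 * (N + 1) + 1)) (by omega)
      rw [← hx, sub_eq_zero.mp h]; ring)
  have hW := vwpSum_weighted Q (Q ^ 4) (Q * (3 - x)) (Q ^ 2 * (x ^ 2 - 3 * x + 3)) N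
    (pow_ne_zero _ hQ0) h1
  rw [sum_deformed_eq_vwpSum Q x _ hQ0 hx hQ]
  have hL : ∑ k ∈ Finset.range (N + 1 + 1),
        (1 - Q ^ (8 * k + 1)) * Q ^ (2 * k) * deformedProd Q ((x - 1) ^ 3) k
          * ((Q ^ (4 * k))⁻¹ + Q ^ (4 * k + 1))
      = ((Q ^ 4) ^ (N + 1))⁻¹ * vwpSum Q (Q ^ 4) (Q * (3 - x)) (Q ^ 2 * (x ^ 2 - 3 * x + 3)) (N + 1)
        + Q * (Q ^ 4) ^ (N + 1)
          * vwpSum Q (Q ^ 4) (Q * (3 - x)) (Q ^ 2 * (x ^ 2 - 3 * x + 3)) (N + 1)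
        + (1 - ((Q ^ 4) ^ (N + 1))⁻¹) * (1 - Q * (Q ^ 4) ^ (N + 1))
          * vwpSum Q (Q ^ 4) (Q * (3 - x)) (Q ^ 2 * (x ^ 2 - 3 * x + 3)) N := by
    rw [← add_mul, ← hW]
    refine Finset.sum_congr rfl fun k _ => ?_
    rw [mul_assoc (1 - Q ^ (8 * k + 1)), deformedProd_eq_vwp Q x (N + 1) k hQ0 hx hQ, pow_mul]
    ring
  rw [hL]
  have hX : (Q ^ 4) ^ (N + 1) = 1 / (x * Q) := by
    rw [eq_div_iff (mul_ne_zero hx0 hQ0), ← hx]; ring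
  have hX' : (Q ^ 4) ^ N = 1 / (x * Q ^ 5) := by
    rw [eq_div_iff (mul_ne_zero hx0 (pow_ne_zero _ hQ0)), ← hx]; ring
  rw [hX'] at hS
  rw [hX]
  generalize vwpSum Q (Q ^ 4) (Q * (3 - x)) (Q ^ 2 * (x ^ 2 - 3 * x + 3)) (N + 1) = S at *
  generalize vwpSum Q (Q ^ 4) (Q * (3 - x)) (Q ^ 2 * (x ^ 2 - 3 * x + 3)) N = S' at *
  clear hW hL
  field_simp at hS ⊢
  linear_combination (x * Q - 1) * hS

/-! ### Sums of y/(1-y)² over roots of unity. -/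

theorem one_sub_sq_mul_sum_mul_sub {F : Type*} [Field F] (y n : F) (m : ℕ) :
    (1 - y) ^ 2 * ∑ k ∈ Finset.range m, (k : F) * (n - k) * y ^ k
      = -2 * ∑ k ∈ Finset.range m, y ^ k + 2 + (n + 1) * y - (m * (n - m) + 2) * y ^ m
        + (m - 1) * (n - m + 1) * y ^ (m + 1) := by
  induction m with
  | zero => simp; ring
  | succ m ih =>
    rw [Finset.sum_range_succ, Finset.sum_range_succ, mul_add, ih]
    push_cast
    ring

/-- This finite Fourier transform of k(n-k) presents y/(1-y)² as a polynomial in y, which can then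
be summed over roots of unity. -/
theorem sum_mul_sub_mul_pow {F : Type*} [Field F] {y : F} {n : ℕ} (hy : y ^ n = 1) (hy1 : y ≠ 1) :
    ∑ k ∈ Finset.range n, (k : F) * (n - k) * y ^ k = 2 * n * (y / (1 - y) ^ 2) := by
  have h1 : 1 - y ≠ 0 := sub_ne_zero.mpr hy1.symm
  have hg : ∑ k ∈ Finset.range n, y ^ k = 0 := by
    have := geom_sum_mul_neg y n
    rw [hy, sub_self] at this
    exact (mul_eq_zero.mp this).resolve_right h1
  have := one_sub_sq_mul_sum_mul_sub y (n : F) n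
  rw [hg, pow_succ y n, hy] at this
  rw [mul_div_assoc', eq_div_iff (pow_ne_zero _ h1), mul_comm, this]
  ring

theorem sum_mul_sub_self {F : Type*} [Field F] [CharZero F] (n : F) (m : ℕ) :
    ∑ k ∈ Finset.range m, (k : F) * (n - k)
      = n * (m * (m - 1) / 2) - m * (m - 1) * (2 * m - 1) / 6 := by
  induction m with
  | zero => simp
  | succ m ih =>
    rw [Finset.sum_range_succ, ih]
    push_cast
    field_simp
    ring

theorem IsPrimitiveRoot.sum_div_one_sub_sq {F : Type*} [Field F] [CharZero F] {z : F} {n : ℕ}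
    (hz : IsPrimitiveRoot z (n + 1)) :
    ∑ j ∈ Finset.range n, z ^ (j + 1) / (1 - z ^ (j + 1)) ^ 2 = -(((n + 1 : F) ^ 2 - 1) / 12) := by
  have hn : (n + 1 : F) ≠ 0 := by exact_mod_cast Nat.succ_ne_zero n
  have h1 : ∀ j ∈ Finset.range n, z ^ (j + 1) / (1 - z ^ (j + 1)) ^ 2
      = (2 * (n + 1 : F))⁻¹ *
        ∑ k ∈ Finset.range (n + 1), (k : F) * (n + 1 - k) * z ^ ((j + 1) * k) := by
    intro j hj
    have h2 := sum_mul_sub_mul_pow (y := z ^ (j + 1)) (n := n + 1)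
      (by rw [← pow_mul, mul_comm, pow_mul, hz.pow_eq_one, one_pow])
      (hz.pow_ne_one_of_pos_of_lt (by omega) (by have := Finset.mem_range.mp hj; omega))
    push_cast at h2
    simp only [pow_mul z (j + 1)]
    rw [h2, inv_mul_cancel_left₀ (mul_ne_zero two_ne_zero hn)]
  rw [Finset.sum_congr rfl h1, ← Finset.mul_sum]
  have h3 : ∑ j ∈ Finset.range (n + 1),
      ∑ k ∈ Finset.range (n + 1), (k : F) * (n + 1 - k) * z ^ (j * k) = 0 := by
    rw [Finset.sum_comm]
    refine Finset.sum_eq_zero fun k hk => ?_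
    rw [← Finset.mul_sum]
    rcases Nat.eq_zero_or_pos k with rfl | hk0
    · simp
    · have hk1 : z ^ k ≠ 1 :=
        hz.pow_ne_one_of_pos_of_lt (by omega) (Finset.mem_range.mp hk)
      have := geom_sum_mul_neg (z ^ k) (n + 1)
      rw [← pow_mul, mul_comm k, pow_mul, hz.pow_eq_one, one_pow, sub_self] at this
      have h4 := (mul_eq_zero.mp this).resolve_right (sub_ne_zero.mpr hk1.symm)
      simp only [mul_comm _ k, pow_mul z k]
      rw [h4, mul_zero]
  rw [Finset.sum_range_succ'] at h3
  simp only [zero_mul, pow_zero, mul_one] at h3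
  rw [eq_neg_of_add_eq_zero_left h3]
  have h5 := sum_mul_sub_self (n + 1 : F) (n + 1)
  rw [h5]
  push_cast
  field_simp
  ring

theorem sum_range_four_mul {F : Type*} [AddCommMonoid F] (f : ℕ → F) (N : ℕ) :
    ∑ j ∈ Finset.range (4 * N), f j = ∑ i ∈ Finset.range N,
      (f (4 * i) + f (4 * i + 1) + f (4 * i + 2) + f (4 * i + 3)) := by
  induction N with
  | zero => simp
  | succ N ih =>
    rw [Finset.sum_range_succ _ N, ← ih, show 4 * (N + 1) = 4 * N + 1 + 1 + 1 + 1 by ring]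
    rw [Finset.sum_range_succ, Finset.sum_range_succ, Finset.sum_range_succ, Finset.sum_range_succ]
    simp only [add_assoc]

/-- The function y/(1-y)² is invariant under y ↦ 1/y, and j ↦ 4N+1-j exchanges the exponent classes
1 with 0 and 3 with 2 modulo 4. Hence the two classes kept here carry half of the full sum. -/
theorem IsPrimitiveRoot.sum_even_div_one_sub_sq {F : Type*} [Field F] [CharZero F] {z : F} {N : ℕ}
    (hz : IsPrimitiveRoot z (4 * N + 1)) :
    ∑ i ∈ Finset.range N, z ^ (4 * i + 4) / (1 - z ^ (4 * i + 4)) ^ 2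
      + ∑ i ∈ Finset.range N, z ^ (4 * i + 2) / (1 - z ^ (4 * i + 2)) ^ 2
      = -(((4 * N + 1 : F) ^ 2 - 1) / 24) := by
  have h := hz.sum_div_one_sub_sq
  have hz0 : z ≠ 0 := hz.ne_zero (by omega)
  have hf : ∀ i j, i + j = 4 * N + 1 → z ^ i / (1 - z ^ i) ^ 2 = z ^ j / (1 - z ^ j) ^ 2 := by
    intro i j hij
    have h1 : z ^ i * z ^ j = 1 := by rw [← pow_add, hij, hz.pow_eq_one]
    have h2 : z ^ i = 1 / z ^ j := by rw [eq_div_iff (pow_ne_zero _ hz0), h1]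
    have h3 : z ^ j ≠ 0 := pow_ne_zero _ hz0
    rw [h2]
    generalize z ^ j = y at *
    rcases eq_or_ne y 1 with rfl | hy
    · simp
    have h4 : 1 - y ≠ 0 := sub_ne_zero.mpr hy.symm
    have h5 : 1 - 1 / y = -(1 - y) / y := by field_simp; ring
    rw [h5]
    field_simp
  rw [sum_range_four_mul (fun j => z ^ (j + 1) / (1 - z ^ (j + 1)) ^ 2)] at h
  simp only [Finset.sum_add_distrib, add_assoc, Nat.reduceAdd] at h
  have e1 : ∑ i ∈ Finset.range N, z ^ (4 * i + 1) / (1 - z ^ (4 * i + 1)) ^ 2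
      = ∑ i ∈ Finset.range N, z ^ (4 * i + 4) / (1 - z ^ (4 * i + 4)) ^ 2 := by
    rw [← Finset.sum_range_reflect]
    refine Finset.sum_congr rfl fun i hi => hf _ _ ?_
    have := Finset.mem_range.mp hi
    omega
  have e2 : ∑ i ∈ Finset.range N, z ^ (4 * i + 3) / (1 - z ^ (4 * i + 3)) ^ 2
      = ∑ i ∈ Finset.range N, z ^ (4 * i + 2) / (1 - z ^ (4 * i + 2)) ^ 2 := by
    rw [← Finset.sum_range_reflect]
    refine Finset.sum_congr rfl fun i hi => hf _ _ ?_
    have := Finset.mem_range.mp hi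
    omega
  rw [e1, e2] at h
  push_cast at h
  linear_combination h / 2

/-! ### Antisymmetry under k ↦ N - k when z^(4N+1) = 1. -/

/-- `(z;z⁴)_k / (z⁴;z⁴)_k`. -/
def qRatio {F : Type*} [Field F] (z : F) (k : ℕ) : F :=
  ∏ i ∈ Finset.range k, ((1 - z ^ (4 * i + 1)) / (1 - z ^ (4 * i + 4)))

theorem qRatio_succ {F : Type*} [Field F] (z : F) (k : ℕ) :
    qRatio z (k + 1) = qRatio z k * ((1 - z ^ (4 * k + 1)) / (1 - z ^ (4 * k + 4))) :=
  Finset.prod_range_succ _ _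

section Reflection

variable {F : Type*} [Field F] {z : F} {N : ℕ}

theorem one_sub_pow_ne_zero_of_reflect (hz : z ^ (4 * N + 1) = 1)
    (h4 : ∀ j, 0 < j → j ≤ N → z ^ (4 * j) ≠ 1) {i : ℕ} (hi : i < N) :
    1 - z ^ (4 * i + 1) ≠ 0 := by
  intro h
  apply h4 (N - i) (by omega) (by omega)
  rw [← hz, show 4 * N + 1 = 4 * (N - i) + (4 * i + 1) by omega, pow_add,
    ← sub_eq_zero.mp h, mul_one]

theorem one_sub_pow_four_ne_zero (h4 : ∀ j, 0 < j → j ≤ N → z ^ (4 * j) ≠ 1) {i : ℕ}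
    (hi : i < N) : 1 - z ^ (4 * i + 4) ≠ 0 :=
  sub_ne_zero.mpr (h4 (i + 1) (by omega) (by omega)).symm

/-- Under i ↦ N-1-i the exponents 4i+1 and 4i+4 become the negatives of 4i+4 and 4i+1, so each
factor turns into its inverse up to a power of z. -/
theorem qRatio_reflect (hz : z ^ (4 * N + 1) = 1) (h4 : ∀ j, 0 < j → j ≤ N → z ^ (4 * j) ≠ 1)
    {k : ℕ} (hk : k ≤ N) : qRatio z (N - k) = qRatio z N * z ^ (3 * k) * qRatio z k := by
  induction k with
  | zero => simp [qRatio]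
  | succ k ih =>
    have h1 := qRatio_succ z (N - (k + 1))
    rw [show N - (k + 1) + 1 = N - k by omega, ih (by omega)] at h1
    have hz0 : z ≠ 0 := by rintro rfl; simp at hz
    have hA := one_sub_pow_ne_zero_of_reflect hz h4 (show k < N by omega)
    have hB := one_sub_pow_four_ne_zero h4 (show k < N by omega)
    have e1 : z ^ (4 * (N - (k + 1)) + 1) = 1 / z ^ (4 * k + 4) := by
      rw [eq_div_iff (pow_ne_zero _ hz0), ← pow_add, ← hz]; congr 1; omega
    have e2 : z ^ (4 * (N - (k + 1)) + 4) = 1 / z ^ (4 * k + 1) := by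
      rw [eq_div_iff (pow_ne_zero _ hz0), ← pow_add, ← hz]; congr 1; omega
    have e3 : (1 - 1 / z ^ (4 * k + 4)) = -(1 - z ^ (4 * k + 4)) / z ^ (4 * k + 4) := by
      field_simp; ring
    have e4 : (1 - 1 / z ^ (4 * k + 1)) = -(1 - z ^ (4 * k + 1)) / z ^ (4 * k + 1) := by
      field_simp; ring
    rw [e1, e2, e3, e4] at h1
    rw [qRatio_succ]
    have e5 : z ^ (4 * k + 4) = z ^ (4 * k + 1) * z ^ 3 := by ring
    have hA0 : z ^ (4 * k + 1) ≠ 0 := pow_ne_zero _ hz0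
    have e6 : -(1 - z ^ (4 * k + 4)) / z ^ (4 * k + 4)
        / (-(1 - z ^ (4 * k + 1)) / z ^ (4 * k + 1))
        = (1 - z ^ (4 * k + 4)) / ((1 - z ^ (4 * k + 1)) * z ^ 3) := by
      generalize 1 - z ^ (4 * k + 4) = b at *
      generalize 1 - z ^ (4 * k + 1) = c at *
      rw [e5]
      generalize z ^ (4 * k + 1) = d at *
      field_simp
    rw [e6, mul_div_assoc', eq_div_iff (mul_ne_zero hA (pow_ne_zero _ hz0))] at h1
    rw [mul_div_assoc', mul_div_assoc', eq_div_iff hB, ← h1]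
    ring

theorem wellPoised_reflect (hz : z ^ (4 * N + 1) = 1)
    (h4 : ∀ j, 0 < j → j ≤ N → z ^ (4 * j) ≠ 1) {k : ℕ} (hk : k ≤ N) :
    (1 - z ^ (8 * (N - k) + 1)) * z ^ (2 * (N - k)) * qRatio z (N - k) ^ 4
      = -((1 - z ^ (8 * k + 1)) * z ^ (2 * k) * qRatio z k ^ 4) := by
  have hz0 : z ≠ 0 := by rintro rfl; simp at hz
  have h1 := qRatio_reflect hz h4 (le_refl N)
  rw [Nat.sub_self, show qRatio z 0 = 1 from Finset.prod_range_zero _] at h1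
  -- The case k = N of the reflection determines the constant only up to sign; the fourth power
  -- removes the ambiguity.
  have h2 : z ^ (6 * N) * qRatio z N ^ 4 = 1 := by
    calc _ = (qRatio z N * z ^ (3 * N) * qRatio z N) ^ 2 := by ring
      _ = 1 := by rw [← h1, one_pow]
  rw [qRatio_reflect hz h4 hk]
  have e1 : z ^ (8 * (N - k) + 1) * z ^ (8 * k + 1) = 1 := by
    rw [← pow_add, show 8 * (N - k) + 1 + (8 * k + 1) = (4 * N + 1) * 2 by omega, pow_mul, hz,
      one_pow]
  have e2 : z ^ (2 * (N - k)) * z ^ (2 * k) = z ^ (2 * N) := by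
    rw [← pow_add]; congr 1; omega
  apply mul_right_cancel₀ (pow_ne_zero (6 * N + 10 * k + 1) hz0)
  calc _ = (z ^ (8 * k + 1) - z ^ (8 * (N - k) + 1) * z ^ (8 * k + 1))
        * (z ^ (2 * (N - k)) * z ^ (2 * k)) * (z ^ (6 * N) * qRatio z N ^ 4)
        * z ^ (12 * k) * qRatio z k ^ 4 := by ring
    _ = -((1 - z ^ (8 * k + 1)) * z ^ (2 * k) * qRatio z k ^ 4)
        * z ^ (2 * N + 10 * k) := by rw [e1, e2, h2]; ring
    _ = -((1 - z ^ (8 * k + 1)) * z ^ (2 * k) * qRatio z k ^ 4)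
        * (z ^ (2 * N + 10 * k) * z ^ (4 * N + 1)) := by rw [hz, mul_one]
    _ = _ := by ring

theorem sum_wellPoised_eq_zero [CharZero F] (hz : z ^ (4 * N + 1) = 1)
    (h4 : ∀ j, 0 < j → j ≤ N → z ^ (4 * j) ≠ 1) (w : ℕ → F) (hw : ∀ k ≤ N, w (N - k) = w k) :
    ∑ k ∈ Finset.range (N + 1),
      (1 - z ^ (8 * k + 1)) * z ^ (2 * k) * qRatio z k ^ 4 * w k = 0 := by
  rw [← self_eq_neg, ← Finset.sum_neg_distrib, ← Finset.sum_range_reflect]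
  refine Finset.sum_congr rfl fun k hk => ?_
  have hk' : k ≤ N := Nat.lt_succ_iff.mp (Finset.mem_range.mp hk)
  rw [show N + 1 - 1 - k = N - k by omega, wellPoised_reflect hz h4 hk', hw k hk']
  ring

/-- The logarithmic derivative of `deformedProd z v k` in `v` at `v = 0`, up to sign. -/
def deformedSlope (z : F) (k : ℕ) : F :=
  ∑ i ∈ Finset.range k,
    ((z ^ (4 * i + 1)) ^ 3 / (1 - z ^ (4 * i + 1)) ^ 3 + 1 / (1 - z ^ (4 * i + 4)) ^ 3)

theorem deformedSlope_reflect [CharZero F] (hz : z ^ (4 * N + 1) = 1)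
    (h4 : ∀ j, 0 < j → j ≤ N → z ^ (4 * j) ≠ 1) {k : ℕ} (hk : k ≤ N) :
    deformedSlope z (N - k) = deformedSlope z k := by
  have hz0 : z ≠ 0 := by rintro rfl; simp at hz
  -- Reflected increments change sign, which gives symmetry up to the additive constant
  -- `deformedSlope z N`; the case k = N shows that twice this constant is zero.
  have key : ∀ k ≤ N, deformedSlope z (N - k) = deformedSlope z N + deformedSlope z k := by
    intro k hk
    induction k with
    | zero => simp [deformedSlope]
    | succ k ih =>
      have h1 : deformedSlope z (N - (k + 1) + 1) = _ := Finset.sum_range_succ _ _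
      have h2 : deformedSlope z (k + 1) = _ := Finset.sum_range_succ _ _
      change _ = deformedSlope z k + _ at h2
      change _ = deformedSlope z (N - (k + 1)) + _ at h1
      rw [show N - (k + 1) + 1 = N - k by omega, ih (by omega)] at h1
      have hA := one_sub_pow_ne_zero_of_reflect hz h4 (show k < N by omega)
      have hB := one_sub_pow_four_ne_zero h4 (show k < N by omega)
      have e1 : z ^ (4 * (N - (k + 1)) + 1) = 1 / z ^ (4 * k + 4) := by
        rw [eq_div_iff (pow_ne_zero _ hz0), ← pow_add, ← hz]; congr 1; omega
      have e2 : z ^ (4 * (N - (k + 1)) + 4) = 1 / z ^ (4 * k + 1) := by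
        rw [eq_div_iff (pow_ne_zero _ hz0), ← pow_add, ← hz]; congr 1; omega
      have e3 : (1 - 1 / z ^ (4 * k + 4)) = -(1 - z ^ (4 * k + 4)) / z ^ (4 * k + 4) := by
        field_simp; ring
      have e4 : (1 - 1 / z ^ (4 * k + 1)) = -(1 - z ^ (4 * k + 1)) / z ^ (4 * k + 1) := by
        field_simp; ring
      have hA0 : z ^ (4 * k + 1) ≠ 0 := pow_ne_zero _ hz0
      have hB0 : z ^ (4 * k + 4) ≠ 0 := pow_ne_zero _ hz0
      have e5 : (1 / z ^ (4 * k + 4)) ^ 3 / (1 - 1 / z ^ (4 * k + 4)) ^ 3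
            + 1 / (1 - 1 / z ^ (4 * k + 1)) ^ 3
          = -((z ^ (4 * k + 1)) ^ 3 / (1 - z ^ (4 * k + 1)) ^ 3
            + 1 / (1 - z ^ (4 * k + 4)) ^ 3) := by
        rw [e3, e4]
        generalize 1 - z ^ (4 * k + 4) = b at *
        generalize 1 - z ^ (4 * k + 1) = c at *
        generalize z ^ (4 * k + 1) = d at *
        generalize z ^ (4 * k + 4) = e at *
        field_simp
        ring
      rw [e1, e2, e5] at h1
      rw [h2]
      linear_combination -h1
  have h5 := key N le_rfl
  rw [Nat.sub_self, show deformedSlope z 0 = 0 from Finset.sum_range_zero _] at h5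
  rw [key k hk]
  linear_combination -h5 / 2

end Reflection

/-! ### Values and orders of vanishing of rational functions at an algebraic number. -/

/-- The rational function `f` has no pole at `ζ` and takes the value `z` there. -/
def SpecializesTo (ζ : ℂ) (f : RatFunc ℚ) (z : ℂ) : Prop :=
  ∃ a b : ℚ[X], aeval ζ b ≠ 0 ∧ f * algebraMap ℚ[X] (RatFunc ℚ) b = algebraMap ℚ[X] (RatFunc ℚ) a
    ∧ z * aeval ζ b = aeval ζ a

namespace SpecializesTo

variable {ζ : ℂ} {f g : RatFunc ℚ} {z w : ℂ}

theorem algebraMap (a : ℚ[X]) :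
    SpecializesTo ζ (algebraMap ℚ[X] (RatFunc ℚ) a) (aeval ζ a) :=
  ⟨a, 1, by simp, by simp, by simp⟩

theorem natCast (n : ℕ) : SpecializesTo ζ (n : RatFunc ℚ) (n : ℂ) := by
  simpa using SpecializesTo.algebraMap (ζ := ζ) (n : ℚ[X])

theorem ofNat (n : ℕ) [n.AtLeastTwo] :
    SpecializesTo ζ (OfNat.ofNat n : RatFunc ℚ) (OfNat.ofNat n : ℂ) := by
  have := natCast (ζ := ζ) (OfNat.ofNat n)
  rwa [Nat.cast_ofNat, Nat.cast_ofNat] at this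

theorem one : SpecializesTo ζ 1 1 := by simpa using natCast (ζ := ζ) 1

theorem zero : SpecializesTo ζ 0 0 := by simpa using natCast (ζ := ζ) 0

theorem X : SpecializesTo ζ RatFunc.X ζ := by
  simpa using SpecializesTo.algebraMap (ζ := ζ) Polynomial.X

theorem add (hf : SpecializesTo ζ f z) (hg : SpecializesTo ζ g w) :
    SpecializesTo ζ (f + g) (z + w) := by
  obtain ⟨a, b, hb, h1, h2⟩ := hf
  obtain ⟨c, d, hd, h3, h4⟩ := hg
  refine ⟨a * d + c * b, b * d, by rw [map_mul]; exact mul_ne_zero hb hd, ?_, ?_⟩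
  · simp only [map_add, map_mul, ← h1, ← h3]; ring
  · simp only [map_add, map_mul, ← h2, ← h4]; ring

theorem mul (hf : SpecializesTo ζ f z) (hg : SpecializesTo ζ g w) :
    SpecializesTo ζ (f * g) (z * w) := by
  obtain ⟨a, b, hb, h1, h2⟩ := hf
  obtain ⟨c, d, hd, h3, h4⟩ := hg
  refine ⟨a * c, b * d, by rw [map_mul]; exact mul_ne_zero hb hd, ?_, ?_⟩
  · simp only [map_mul, ← h1, ← h3]; ring
  · simp only [map_mul, ← h2, ← h4]; ring

theorem neg (hf : SpecializesTo ζ f z) : SpecializesTo ζ (-f) (-z) := by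
  obtain ⟨a, b, hb, h1, h2⟩ := hf
  exact ⟨-a, b, hb, by simp [h1], by simp [h2]⟩

theorem sub (hf : SpecializesTo ζ f z) (hg : SpecializesTo ζ g w) :
    SpecializesTo ζ (f - g) (z - w) := by
  simpa only [sub_eq_add_neg] using hf.add hg.neg

theorem ne_zero (hf : SpecializesTo ζ f z) (hz : z ≠ 0) : f ≠ 0 := by
  rintro rfl
  obtain ⟨a, b, hb, h1, h2⟩ := hf
  rw [zero_mul, eq_comm, map_eq_zero_iff _ (RatFunc.algebraMap_injective ℚ)] at h1
  rw [h1, map_zero] at h2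
  exact (mul_ne_zero hz hb) h2

theorem inv (hf : SpecializesTo ζ f z) (hz : z ≠ 0) : SpecializesTo ζ f⁻¹ z⁻¹ := by
  have hf0 := hf.ne_zero hz
  obtain ⟨a, b, hb, h1, h2⟩ := hf
  refine ⟨b, a, by rw [← h2]; exact mul_ne_zero hz hb, ?_, ?_⟩
  · rw [← h1, inv_mul_cancel_left₀ hf0]
  · rw [← h2, inv_mul_cancel_left₀ hz]

theorem div (hf : SpecializesTo ζ f z) (hg : SpecializesTo ζ g w) (hw : w ≠ 0) :
    SpecializesTo ζ (f / g) (z / w) := by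
  simpa only [div_eq_mul_inv] using hf.mul (hg.inv hw)

theorem pow (hf : SpecializesTo ζ f z) (n : ℕ) : SpecializesTo ζ (f ^ n) (z ^ n) := by
  induction n with
  | zero => simpa using one
  | succ n ih => simpa only [pow_succ] using ih.mul hf

theorem sum {ι : Type*} {s : Finset ι} {f : ι → RatFunc ℚ} {z : ι → ℂ}
    (h : ∀ i ∈ s, SpecializesTo ζ (f i) (z i)) :
    SpecializesTo ζ (∑ i ∈ s, f i) (∑ i ∈ s, z i) := by
  classical
  induction s using Finset.induction_on with
  | empty => simpa using zero
  | insert i s hi ih =>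
    rw [Finset.sum_insert hi, Finset.sum_insert hi]
    exact (h i (Finset.mem_insert_self i s)).add
      (ih fun j hj => h j (Finset.mem_insert_of_mem hj))

theorem prod {ι : Type*} {s : Finset ι} {f : ι → RatFunc ℚ} {z : ι → ℂ}
    (h : ∀ i ∈ s, SpecializesTo ζ (f i) (z i)) :
    SpecializesTo ζ (∏ i ∈ s, f i) (∏ i ∈ s, z i) := by
  classical
  induction s using Finset.induction_on with
  | empty => simpa using one
  | insert i s hi ih =>
    rw [Finset.prod_insert hi, Finset.prod_insert hi]
    exact (h i (Finset.mem_insert_self i s)).mul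
      (ih fun j hj => h j (Finset.mem_insert_of_mem hj))

theorem qInt (hf : SpecializesTo ζ f z) (n : ℕ) : SpecializesTo ζ (qInt f n) (qInt z n) :=
  sum fun i _ => hf.pow i

theorem one_sub_pow (hf : SpecializesTo ζ f z) (n : ℕ) :
    SpecializesTo ζ (1 - f ^ n) (1 - z ^ n) := one.sub (hf.pow n)

end SpecializesTo

/-- The rational function `f` vanishes to order at least `m` at `ζ` and its conjugates. -/
def VanishesTo (ζ : ℂ) (m : ℕ) (f : RatFunc ℚ) : Prop :=
  ∃ g z, SpecializesTo ζ g z ∧ f = algebraMap ℚ[X] (RatFunc ℚ) (minpoly ℚ ζ) ^ m * g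

namespace VanishesTo

variable {ζ : ℂ} {f g : RatFunc ℚ} {m k : ℕ}

theorem of_specializesTo {z : ℂ} (h : SpecializesTo ζ f z) : VanishesTo ζ 0 f :=
  ⟨f, z, h, by simp⟩

theorem of_specializesTo_zero (h : SpecializesTo ζ f 0) : VanishesTo ζ 1 f := by
  obtain ⟨a, b, hb, h1, h2⟩ := h
  rw [zero_mul] at h2
  obtain ⟨c, rfl⟩ := minpoly.dvd ℚ ζ h2.symm
  have hb' := (SpecializesTo.algebraMap (ζ := ζ) b).ne_zero hb
  refine ⟨algebraMap ℚ[X] (RatFunc ℚ) c / algebraMap ℚ[X] (RatFunc ℚ) b, _,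
    (SpecializesTo.algebraMap c).div (SpecializesTo.algebraMap b) hb, ?_⟩
  rw [pow_one, mul_div_assoc', eq_div_iff hb', h1, map_mul]

theorem zero : VanishesTo ζ m 0 := ⟨0, 0, SpecializesTo.zero, by simp⟩

theorem add (hf : VanishesTo ζ m f) (hg : VanishesTo ζ m g) : VanishesTo ζ m (f + g) := by
  obtain ⟨a, z, h1, rfl⟩ := hf
  obtain ⟨b, w, h2, rfl⟩ := hg
  exact ⟨a + b, z + w, h1.add h2, by ring⟩

theorem neg (hf : VanishesTo ζ m f) : VanishesTo ζ m (-f) := by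
  obtain ⟨a, z, h1, rfl⟩ := hf
  exact ⟨-a, -z, h1.neg, by ring⟩

theorem sub (hf : VanishesTo ζ m f) (hg : VanishesTo ζ m g) : VanishesTo ζ m (f - g) := by
  simpa only [sub_eq_add_neg] using hf.add hg.neg

theorem mul (hf : VanishesTo ζ m f) (hg : VanishesTo ζ k g) : VanishesTo ζ (m + k) (f * g) := by
  obtain ⟨a, z, h1, rfl⟩ := hf
  obtain ⟨b, w, h2, rfl⟩ := hg
  exact ⟨a * b, z * w, h1.mul h2, by ring⟩

theorem mul_specializesTo {z : ℂ} (hf : VanishesTo ζ m f) (hg : SpecializesTo ζ g z) :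
    VanishesTo ζ m (f * g) := hf.mul (of_specializesTo hg)

theorem specializesTo_mul {z : ℂ} (hg : SpecializesTo ζ g z) (hf : VanishesTo ζ m f) :
    VanishesTo ζ m (g * f) := mul_comm f g ▸ hf.mul_specializesTo hg

theorem pow (hf : VanishesTo ζ m f) (k : ℕ) : VanishesTo ζ (m * k) (f ^ k) := by
  obtain ⟨a, z, h1, rfl⟩ := hf
  exact ⟨a ^ k, z ^ k, h1.pow k, by rw [mul_pow, pow_mul]⟩

theorem specializesTo_minpoly :
    SpecializesTo ζ (algebraMap ℚ[X] (RatFunc ℚ) (minpoly ℚ ζ)) 0 := by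
  simpa using SpecializesTo.algebraMap (ζ := ζ) (minpoly ℚ ζ)

theorem mono (hf : VanishesTo ζ m f) (h : k ≤ m) : VanishesTo ζ k f := by
  obtain ⟨a, z, h1, rfl⟩ := hf
  refine ⟨_, _, (specializesTo_minpoly.pow (m - k)).mul h1, ?_⟩
  rw [← mul_assoc, ← pow_add, Nat.add_sub_cancel' h]

theorem specializesTo (hf : VanishesTo ζ m f) (h : 0 < m) : SpecializesTo ζ f 0 := by
  obtain ⟨a, z, h1, rfl⟩ := hf
  simpa [h.ne'] using (specializesTo_minpoly.pow m).mul h1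

theorem sum {ι : Type*} {s : Finset ι} {f : ι → RatFunc ℚ}
    (h : ∀ i ∈ s, VanishesTo ζ m (f i)) : VanishesTo ζ m (∑ i ∈ s, f i) := by
  classical
  induction s using Finset.induction_on with
  | empty => simpa using zero
  | insert i s hi ih =>
    rw [Finset.sum_insert hi]
    exact (h i (Finset.mem_insert_self i s)).add
      (ih fun j hj => h j (Finset.mem_insert_of_mem hj))

theorem pow_dvd_num (hζ : IsIntegral ℚ ζ) (hf : VanishesTo ζ m f) :
    minpoly ℚ ζ ^ m ∣ f.num := by
  obtain ⟨g, z, ⟨a, b, hb, h1, -⟩, hfg⟩ := hf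
  have hbd : ¬ minpoly ℚ ζ ∣ b := by
    rintro ⟨c, rfl⟩
    simp at hb
  refine (minpoly.prime hζ).pow_dvd_of_dvd_mul_right m hbd ⟨a * f.denom, ?_⟩
  apply RatFunc.algebraMap_injective ℚ
  have h2 := RatFunc.num_div_denom f
  rw [div_eq_iff (RatFunc.algebraMap_ne_zero f.denom_ne_zero)] at h2
  simp only [map_mul, map_pow]
  rw [h2, ← h1]
  nth_rw 1 [hfg]
  ring

end VanishesTo

/-! ### Nonvanishing at roots of odd order, and comparison of products. -/

theorem IsPrimitiveRoot.pow_four_mul_ne_one {F : Type*} [Field F] {z : F} {N j : ℕ}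
    (hz : IsPrimitiveRoot z (4 * N + 1)) (hj : 0 < j) (hjN : j < 4 * N + 1) : z ^ (4 * j) ≠ 1 := by
  rw [Ne, hz.pow_eq_one_iff_dvd]
  intro h
  have hc : Nat.Coprime (4 * N + 1) 4 := by simp
  exact absurd (Nat.le_of_dvd hj (hc.dvd_of_dvd_mul_left h)) (by omega)

theorem IsPrimitiveRoot.sq_ne_one {F : Type*} [Field F] {z : F} {N : ℕ}
    (hz : IsPrimitiveRoot z (4 * N + 1)) (hN : 0 < N) : z ^ 2 ≠ 1 :=
  hz.pow_ne_one_of_pos_of_lt (by omega) (by omega)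

theorem IsPrimitiveRoot.one_add_ne_zero {F : Type*} [Field F] {z : F} {N : ℕ}
    (hz : IsPrimitiveRoot z (4 * N + 1)) (hN : 0 < N) : 1 + z ≠ 0 := by
  intro h
  apply hz.sq_ne_one hN
  rw [← neg_eq_of_add_eq_zero_right h]
  ring

theorem VanishesTo.prod_sub_prod {ζ : ℂ} {m : ℕ} {ι : Type*} {s : Finset ι} {f g : ι → RatFunc ℚ}
    {z w : ι → ℂ} (hf : ∀ i ∈ s, SpecializesTo ζ (f i) (z i))
    (hg : ∀ i ∈ s, SpecializesTo ζ (g i) (w i)) (h : ∀ i ∈ s, VanishesTo ζ m (f i - g i)) :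
    VanishesTo ζ m (∏ i ∈ s, f i - ∏ i ∈ s, g i) := by
  classical
  induction s using Finset.induction_on with
  | empty => simpa using VanishesTo.zero
  | insert i s hi ih =>
    rw [Finset.prod_insert hi, Finset.prod_insert hi]
    have h1 := ih (fun j hj => hf j (Finset.mem_insert_of_mem hj))
      (fun j hj => hg j (Finset.mem_insert_of_mem hj))
      (fun j hj => h j (Finset.mem_insert_of_mem hj))
    have h2 := SpecializesTo.prod (ζ := ζ) (fun j hj => hg j (Finset.mem_insert_of_mem hj))
    have h3 := h i (Finset.mem_insert_self i s)
    have h4 := hf i (Finset.mem_insert_self i s)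
    have := (VanishesTo.specializesTo_mul h4 h1).add (h3.mul_specializesTo h2)
    convert this using 1
    ring

/-- First-order expansion of a product: every omitted term contains t². -/
theorem VanishesTo.prod_one_sub {ζ : ℂ} {m : ℕ} {t : RatFunc ℚ} {b : ℕ → RatFunc ℚ} {w : ℕ → ℂ}
    (ht : VanishesTo ζ m t) {N : ℕ} (hb : ∀ i < N, SpecializesTo ζ (b i) (w i)) :
    VanishesTo ζ (m * 2) (∏ i ∈ Finset.range N, (1 - t * b i)
      - (1 - t * ∑ i ∈ Finset.range N, b i)) := by
  have ht' : ∃ y, SpecializesTo ζ t y := by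
    obtain ⟨g, y, h, rfl⟩ := ht
    exact ⟨_, (VanishesTo.specializesTo_minpoly.pow m).mul h⟩
  obtain ⟨y, ht'⟩ := ht'
  induction N with
  | zero => simpa using VanishesTo.zero
  | succ N ih =>
    rw [Finset.prod_range_succ, Finset.sum_range_succ]
    have h1 := hb N (by omega)
    have h2 := (ih fun i hi => hb i (by omega)).mul_specializesTo
      (SpecializesTo.one.sub (ht'.mul h1))
    have h3 := ((ht.pow 2).mul_specializesTo h1).mul_specializesTo
      (SpecializesTo.sum (s := Finset.range N)
        (fun i hi => hb i (by have := Finset.mem_range.mp hi; omega)))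
    convert h2.add h3 using 1
    ring

/-! ### The deformation changes the sums only to order four. -/

section Congruence

variable {ζ z : ℂ} {Q : RatFunc ℚ} {N : ℕ}

theorem specializesTo_numer (hQz : SpecializesTo ζ Q z) (hz : IsPrimitiveRoot z (4 * N + 1))
    {i : ℕ} (hi : i < N) :
    SpecializesTo ζ (1 - Q ^ (4 * i + 1)) (1 - z ^ (4 * i + 1)) ∧ 1 - z ^ (4 * i + 1) ≠ 0 :=
  ⟨hQz.one_sub_pow _, sub_ne_zero.mpr (hz.pow_ne_one_of_pos_of_lt (by omega) (by omega)).symm⟩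

theorem specializesTo_denom (hQz : SpecializesTo ζ Q z) (hz : IsPrimitiveRoot z (4 * N + 1))
    {i : ℕ} (hi : i < 4 * N) :
    SpecializesTo ζ (1 - Q ^ (4 * i + 4)) (1 - z ^ (4 * i + 4)) ∧ 1 - z ^ (4 * i + 4) ≠ 0 :=
  ⟨hQz.one_sub_pow _, sub_ne_zero.mpr (hz.pow_four_mul_ne_one (j := i + 1) (by omega)
    (by omega)).symm⟩

theorem specializesTo_qRatio (hQz : SpecializesTo ζ Q z) (hz : IsPrimitiveRoot z (4 * N + 1))
    {k : ℕ} (hk : k ≤ 4 * N) : SpecializesTo ζ (qRatio Q k) (qRatio z k) := by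
  refine SpecializesTo.prod fun i hi => ?_
  have h := specializesTo_denom hQz hz (i := i) (by have := Finset.mem_range.mp hi; omega)
  exact (hQz.one_sub_pow _).div h.1 h.2

theorem specializesTo_deformedSlope (hQz : SpecializesTo ζ Q z)
    (hz : IsPrimitiveRoot z (4 * N + 1)) {k : ℕ} (hk : k ≤ N) :
    SpecializesTo ζ (deformedSlope Q k) (deformedSlope z k) := by
  refine SpecializesTo.sum fun i hi => ?_
  have hi' := Finset.mem_range.mp hi
  have hA := specializesTo_numer hQz hz (i := i) (by omega)
  have hB := specializesTo_denom hQz hz (i := i) (by omega)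
  exact (((hQz.pow _).pow 3).div (hA.1.pow 3) (pow_ne_zero 3 hA.2)).add
    (SpecializesTo.one.div (hB.1.pow 3) (pow_ne_zero 3 hB.2))

theorem deformedProd_linear_approx (hQz : SpecializesTo ζ Q z)
    (hz : IsPrimitiveRoot z (4 * N + 1)) {v : RatFunc ℚ} (hv : VanishesTo ζ 3 v) {k : ℕ}
    (hk : k ≤ N) :
    VanishesTo ζ 6 (deformedProd Q v k - qRatio Q k ^ 4 * (1 - v * deformedSlope Q k)) := by
  induction k with
  | zero => simpa [deformedProd, qRatio, deformedSlope] using VanishesTo.zero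
  | succ k ih =>
    have hv0 := hv.specializesTo (by norm_num)
    have hA := specializesTo_numer hQz hz (i := k) (by omega)
    have hB := specializesTo_denom hQz hz (i := k) (by omega)
    have hg := specializesTo_qRatio hQz hz (k := k) (by omega)
    have hL := specializesTo_deformedSlope hQz hz (k := k) (by omega)
    have hA3 := (hQz.pow (4 * k + 1)).pow 3
    have hsl := (hA3.div (hA.1.pow 3) (pow_ne_zero 3 hA.2)).add
      (SpecializesTo.one.div (hB.1.pow 3) (pow_ne_zero 3 hB.2))
    have hrho := ((hA.1.div hB.1 hB.2).pow 4)
    have hbv := (hB.1.pow 3).add hv0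
    rw [add_zero] at hbv
    have hr := (hA.1.mul ((hA.1.pow 3).sub (hA3.mul hv0))).div (hB.1.mul hbv)
      (mul_ne_zero hB.2 (pow_ne_zero 3 hB.2))
    -- The error has three sources: the earlier error times the new factor, the second-order
    -- remainder of the new factor, and the product of the two linear terms.
    have h1 := (ih (by omega)).mul_specializesTo hr
    have hv2 := hv.pow 2
    have h2 := hv2.mul_specializesTo (((hg.pow 4).mul (SpecializesTo.one.sub (hv0.mul hL))).mul
      ((hrho.mul hsl).div hbv (pow_ne_zero 3 hB.2)))
    have h3 := hv2.mul_specializesTo (((hg.pow 4).mul hrho).mul (hL.mul hsl))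
    have e1 : deformedProd Q v (k + 1) = deformedProd Q v k * _ := Finset.prod_range_succ _ _
    have e2 : deformedSlope Q (k + 1) = deformedSlope Q k + _ := Finset.sum_range_succ _ _
    rw [e1, e2, qRatio_succ]
    convert (h1.add h2).add h3 using 1
    have hA0 := hA.1.ne_zero hA.2
    have hB0 := hB.1.ne_zero hB.2
    have hbv0 := hbv.ne_zero (pow_ne_zero 3 hB.2)
    generalize 1 - Q ^ (4 * k + 1) = a at *
    generalize Q ^ (4 * k + 1) = A at *
    generalize 1 - Q ^ (4 * k + 4) = b at *
    obtain ⟨c, hc⟩ : ∃ c, c = b ^ 3 + v := ⟨_, rfl⟩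
    rw [← hc] at hbv0 ⊢
    generalize deformedProd Q v k = P
    generalize qRatio Q k = g
    generalize deformedSlope Q k = L
    have hv' : v = c - b ^ 3 := by rw [hc]; ring
    clear h1 h2 h3 hv2 hr hbv hv hv0 ih
    subst hv'
    field_simp
    ring

/-- The linear term is v, of order three, times a sum with weight w · slope. Both are symmetric
under the reflection, so that sum vanishes at ζ and the total order is four. -/
theorem sum_deformed_sub (hQz : SpecializesTo ζ Q z) (hz : IsPrimitiveRoot z (4 * N + 1))
    {v : RatFunc ℚ} (hv : VanishesTo ζ 3 v) (W : ℕ → RatFunc ℚ) (w : ℕ → ℂ)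
    (hW : ∀ k ≤ N, SpecializesTo ζ (W k) (w k)) (hw : ∀ k ≤ N, w (N - k) = w k) :
    VanishesTo ζ 4 (∑ k ∈ Finset.range (N + 1), (1 - Q ^ (8 * k + 1)) * Q ^ (2 * k)
        * deformedProd Q v k * W k
      - ∑ k ∈ Finset.range (N + 1), (1 - Q ^ (8 * k + 1)) * Q ^ (2 * k)
        * qRatio Q k ^ 4 * W k) := by
  have h4 : ∀ j, 0 < j → j ≤ N → z ^ (4 * j) ≠ 1 :=
    fun j h1 h2 => hz.pow_four_mul_ne_one h1 (by omega)
  have h1 : VanishesTo ζ 4 (∑ k ∈ Finset.range (N + 1), (1 - Q ^ (8 * k + 1)) * Q ^ (2 * k)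
      * W k * (deformedProd Q v k - qRatio Q k ^ 4 * (1 - v * deformedSlope Q k))) := by
    refine VanishesTo.sum fun k hk => ?_
    have hk' : k ≤ N := Nat.lt_succ_iff.mp (Finset.mem_range.mp hk)
    exact (VanishesTo.specializesTo_mul (((hQz.one_sub_pow _).mul (hQz.pow _)).mul (hW k hk'))
      (deformedProd_linear_approx hQz hz hv hk')).mono (by norm_num)
  have h2 : SpecializesTo ζ (∑ k ∈ Finset.range (N + 1), (1 - Q ^ (8 * k + 1)) * Q ^ (2 * k)
      * qRatio Q k ^ 4 * (W k * deformedSlope Q k)) 0 := by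
    rw [← sum_wellPoised_eq_zero hz.pow_eq_one h4 (fun k => w k * deformedSlope z k)
      (fun k hk => by
        simp only [hw k hk, deformedSlope_reflect hz.pow_eq_one h4 hk])]
    refine SpecializesTo.sum fun k hk => ?_
    have hk' : k ≤ N := Nat.lt_succ_iff.mp (Finset.mem_range.mp hk)
    exact (((hQz.one_sub_pow _).mul (hQz.pow _)).mul
      ((specializesTo_qRatio hQz hz (by omega)).pow 4)).mul
      ((hW k hk').mul (specializesTo_deformedSlope hQz hz hk'))
  have h3 := hv.mul (VanishesTo.of_specializesTo_zero h2)
  convert h1.sub h3 using 1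
  rw [Finset.mul_sum, ← Finset.sum_sub_distrib, ← Finset.sum_sub_distrib]
  refine Finset.sum_congr rfl fun k _ => ?_
  ring

end Congruence

/-! ### Expansion of the closed form and the congruences modulo Φ_n⁴. -/

theorem sum_Icc_one_eq_sum_range {F : Type*} [AddCommMonoid F] (f : ℕ → F) (N : ℕ) :
    ∑ k ∈ Finset.Icc 1 N, f k = ∑ i ∈ Finset.range N, f (i + 1) := by
  rw [Finset.range_eq_Ico, Finset.sum_Ico_add', zero_add]
  rfl

/-- The length `N` is kept apart from `M` so that the relation fixing `x` stays unchanged during the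
induction. -/
theorem prod_mul_pow_eq {K : Type*} [Field K] (Q x : K) (N M : ℕ)
    (hx : x * Q ^ (4 * M + 1) = 1) :
    (∏ i ∈ Finset.range N, (x * Q ^ (4 * i + 4) * Q ^ (4 * i + 2))) * Q ^ (N * (4 * M + 1))
      = Q ^ (N * (4 * N + 2)) := by
  induction N with
  | zero => simp
  | succ N ih =>
    rw [Finset.prod_range_succ]
    calc _ = ((∏ i ∈ Finset.range N, (x * Q ^ (4 * i + 4) * Q ^ (4 * i + 2)))
          * Q ^ (N * (4 * M + 1))) * Q ^ (8 * N + 6) * (x * Q ^ (4 * M + 1)) := by ring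
      _ = _ := by rw [ih, hx]; ring

theorem prod_mul_pow_eq_pow {K : Type*} [Field K] (Q x : K) (N : ℕ) (hQ0 : Q ≠ 0)
    (hx : x * Q ^ (4 * N + 1) = 1) :
    ∏ i ∈ Finset.range N, (x * Q ^ (4 * i + 4) * Q ^ (4 * i + 2)) = Q ^ N := by
  have := prod_mul_pow_eq Q x N N hx
  apply mul_right_cancel₀ (pow_ne_zero (N * (4 * N + 1)) hQ0)
  rw [this]
  ring

theorem qShift_div_qShift {K : Type*} [Field K] (Q : K) (s k : ℕ) :
    qShift (Q ^ s) (Q ^ 4) k / qShift (Q ^ 4) (Q ^ 4) k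
      = ∏ i ∈ Finset.range k, ((1 - Q ^ (4 * i + s)) / (1 - Q ^ (4 * i + 4))) := by
  rw [qShift, qShift, ← Finset.prod_div_distrib]
  refine Finset.prod_congr rfl fun i _ => ?_
  congr 2 <;> ring

theorem qInt_sq_mul_qB {K : Type*} [Field K] [CharZero K] (Q : K) (N : ℕ) (hQ : Q ≠ 1) :
    qInt Q (4 * N + 1) ^ 2 * qB (4 * N + 1) Q
      = (1 - Q ^ (4 * N + 1)) ^ 2 * (((4 * N + 1 : K) ^ 2 - 1) / 24
        + ∑ i ∈ Finset.range N, Q ^ (4 * i + 2) / (1 - Q ^ (4 * i + 2)) ^ 2) := by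
  have h1 : 1 - Q ≠ 0 := sub_ne_zero.mpr hQ.symm
  rw [qB, Nat.add_sub_cancel, Nat.mul_div_cancel_left _ (by norm_num), sum_Icc_one_eq_sum_range,
    qInt_eq_div Q hQ]
  have h2 : ∑ i ∈ Finset.range N, Q ^ (4 * (i + 1) - 2) / qInt Q (4 * (i + 1) - 2) ^ 2
      = (1 - Q) ^ 2 * ∑ i ∈ Finset.range N, Q ^ (4 * i + 2) / (1 - Q ^ (4 * i + 2)) ^ 2 := by
    rw [Finset.mul_sum]
    refine Finset.sum_congr rfl fun i _ => ?_
    rw [show 4 * (i + 1) - 2 = 4 * i + 2 by omega, qInt_eq_div Q hQ, div_pow, div_div_eq_mul_div]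
    ring
  rw [h2]
  push_cast
  field_simp

section Congruence

variable {ζ z : ℂ} {Q : RatFunc ℚ} {N : ℕ}

theorem specializesTo_middle (hQz : SpecializesTo ζ Q z) (hz : IsPrimitiveRoot z (4 * N + 1))
    {i : ℕ} (hi : i < N) :
    SpecializesTo ζ (1 - Q ^ (4 * i + 2)) (1 - z ^ (4 * i + 2)) ∧ 1 - z ^ (4 * i + 2) ≠ 0 :=
  ⟨hQz.one_sub_pow _, sub_ne_zero.mpr (hz.pow_ne_one_of_pos_of_lt (by omega) (by omega)).symm⟩

theorem vanishesTo_one_sub_pow (hQz : SpecializesTo ζ Q z) {n : ℕ} (hz : z ^ n = 1) :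
    VanishesTo ζ 1 (1 - Q ^ n) := by
  have h := hQz.one_sub_pow n
  rw [hz, sub_self] at h
  exact VanishesTo.of_specializesTo_zero h

/-- The harmonic-type sum which appears in the second-order term. -/
theorem vanishesTo_harmonic (hQz : SpecializesTo ζ Q z) (hz : IsPrimitiveRoot z (4 * N + 1))
    {x : RatFunc ℚ} (hx1 : SpecializesTo ζ x 1) :
    VanishesTo ζ 1 (x * ∑ i ∈ Finset.range N, Q ^ (4 * i + 4) / (1 - Q ^ (4 * i + 4)) ^ 2
      + (((4 * N + 1 : RatFunc ℚ) ^ 2 - 1) / 24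
        + ∑ i ∈ Finset.range N, Q ^ (4 * i + 2) / (1 - Q ^ (4 * i + 2)) ^ 2)) := by
  apply VanishesTo.of_specializesTo_zero
  have h1 : SpecializesTo ζ (∑ i ∈ Finset.range N, Q ^ (4 * i + 4) / (1 - Q ^ (4 * i + 4)) ^ 2)
      (∑ i ∈ Finset.range N, z ^ (4 * i + 4) / (1 - z ^ (4 * i + 4)) ^ 2) := by
    refine SpecializesTo.sum fun i hi => ?_
    have h := specializesTo_denom hQz hz (i := i) (by have := Finset.mem_range.mp hi; omega)
    exact (hQz.pow _).div (h.1.pow 2) (pow_ne_zero 2 h.2)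
  have h2 : SpecializesTo ζ (∑ i ∈ Finset.range N, Q ^ (4 * i + 2) / (1 - Q ^ (4 * i + 2)) ^ 2)
      (∑ i ∈ Finset.range N, z ^ (4 * i + 2) / (1 - z ^ (4 * i + 2)) ^ 2) := by
    refine SpecializesTo.sum fun i hi => ?_
    have h := specializesTo_middle hQz hz (Finset.mem_range.mp hi)
    exact (hQz.pow _).div (h.1.pow 2) (pow_ne_zero 2 h.2)
  have h3 := ((((SpecializesTo.ofNat (ζ := ζ) 4).mul (SpecializesTo.natCast N)).add
    SpecializesTo.one).pow 2).sub SpecializesTo.one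
  have h4 := (hx1.mul h1).add ((h3.div (SpecializesTo.ofNat 24) (by norm_num)).add h2)
  convert h4 using 1
  linear_combination -hz.sum_even_div_one_sub_sq

/-- With B = Q^(4i+4), the identity (1-xB)(x-B)/x = (1-B)² - B(x-1)²/x shows that the deviation from
the undeformed product is of second order, while v is already of third order. The resulting
coefficient -∑ B/(1-B)² is replaced by means of `vanishesTo_harmonic`. -/
theorem prod_closed_form_approx (hQz : SpecializesTo ζ Q z) (hQ0 : Q ≠ 0) (hQ1 : Q ≠ 1)
    (hz : IsPrimitiveRoot z (4 * N + 1)) {x : RatFunc ℚ} (hx : x * Q ^ (4 * N + 1) = 1) :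
    VanishesTo ζ 3 (∏ i ∈ Finset.range N,
        ((1 - x * Q ^ (4 * i + 4)) * (x - Q ^ (4 * i + 4))
            * (1 - Q ^ (4 * i + 2) * (1 + (x - 1) ^ 3))
          / (x ^ 2 * Q ^ (4 * i + 4) * Q ^ (4 * i + 2)
            * ((1 - Q ^ (4 * i + 4)) ^ 3 + (x - 1) ^ 3)))
      - (Q ^ N)⁻¹ * (qShift (Q ^ 2) (Q ^ 4) N / qShift (Q ^ 4) (Q ^ 4) N)
        * (1 + qInt Q (4 * N + 1) ^ 2 * qB (4 * N + 1) Q)) := by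
  have hz0 : z ≠ 0 := hz.ne_zero (by omega)
  have hx0 : x ≠ 0 := left_ne_zero_of_mul_eq_one hx
  have hx1 : SpecializesTo ζ x 1 := by
    have := (hQz.pow (4 * N + 1)).inv (pow_ne_zero _ hz0)
    rwa [hz.pow_eq_one, inv_one, ← eq_inv_of_mul_eq_one_left hx] at this
  have hu : VanishesTo ζ 1 (x - 1) :=
    VanishesTo.of_specializesTo_zero (by simpa using hx1.sub SpecializesTo.one)
  have hv : VanishesTo ζ 3 ((x - 1) ^ 3) := hu.pow 3
  have hv0 := hv.specializesTo (by norm_num)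
  have ht : VanishesTo ζ 2 ((x - 1) ^ 2 / x) := by
    rw [div_eq_mul_inv]
    exact (hu.pow 2).mul_specializesTo (hx1.inv one_ne_zero)
  have ht0 := ht.specializesTo (by norm_num)
  have hd : ∀ i < N, SpecializesTo ζ ((1 - Q ^ (4 * i + 4)) ^ 3 + (x - 1) ^ 3)
      ((1 - z ^ (4 * i + 4)) ^ 3) := by
    intro i hi
    have hB := specializesTo_denom hQz hz (i := i) (by omega)
    simpa using (hB.1.pow 3).add hv0
  have e1 : ∏ i ∈ Finset.range N,
        ((1 - x * Q ^ (4 * i + 4)) * (x - Q ^ (4 * i + 4))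
            * (1 - Q ^ (4 * i + 2) * (1 + (x - 1) ^ 3))
          / (x ^ 2 * Q ^ (4 * i + 4) * Q ^ (4 * i + 2)
            * ((1 - Q ^ (4 * i + 4)) ^ 3 + (x - 1) ^ 3)))
      = (Q ^ N)⁻¹ * ∏ i ∈ Finset.range N,
        (((1 - Q ^ (4 * i + 4)) ^ 2 - Q ^ (4 * i + 4) * ((x - 1) ^ 2 / x))
          * (1 - Q ^ (4 * i + 2) * (1 + (x - 1) ^ 3))
          / ((1 - Q ^ (4 * i + 4)) ^ 3 + (x - 1) ^ 3)) := by
    rw [← prod_mul_pow_eq_pow Q x N hQ0 hx, ← Finset.prod_inv_distrib, ← Finset.prod_mul_distrib]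
    refine Finset.prod_congr rfl fun i _ => ?_
    have h1 : (1 - Q ^ (4 * i + 4)) ^ 2 - Q ^ (4 * i + 4) * ((x - 1) ^ 2 / x)
        = (1 - x * Q ^ (4 * i + 4)) * (x - Q ^ (4 * i + 4)) / x := by
      field_simp; ring
    rw [h1]
    simp only [div_eq_mul_inv, mul_inv]
    ring
  have h1 : VanishesTo ζ 3 (∏ i ∈ Finset.range N,
        (((1 - Q ^ (4 * i + 4)) ^ 2 - Q ^ (4 * i + 4) * ((x - 1) ^ 2 / x))
          * (1 - Q ^ (4 * i + 2) * (1 + (x - 1) ^ 3))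
          / ((1 - Q ^ (4 * i + 4)) ^ 3 + (x - 1) ^ 3))
      - ∏ i ∈ Finset.range N, ((1 - Q ^ (4 * i + 2)) / (1 - Q ^ (4 * i + 4))
        * (1 - (x - 1) ^ 2 / x * (Q ^ (4 * i + 4) / (1 - Q ^ (4 * i + 4)) ^ 2)))) := by
    have hb : ∀ i ∈ Finset.range N, _ := fun i hi =>
      ((((specializesTo_denom hQz hz (i := i)
        (by have := Finset.mem_range.mp hi; omega)).1.pow 2).sub ((hQz.pow (4 * i + 4)).mul ht0)).mul
        (SpecializesTo.one.sub ((hQz.pow (4 * i + 2)).mul (SpecializesTo.one.add hv0)))).div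
        (hd i (Finset.mem_range.mp hi)) (pow_ne_zero 3 (specializesTo_denom hQz hz (i := i)
        (by have := Finset.mem_range.mp hi; omega)).2)
    have hc : ∀ i ∈ Finset.range N, _ := fun i hi =>
      ((specializesTo_middle hQz hz (Finset.mem_range.mp hi)).1.div
        (specializesTo_denom hQz hz (i := i) (by have := Finset.mem_range.mp hi; omega)).1
        (specializesTo_denom hQz hz (i := i) (by have := Finset.mem_range.mp hi; omega)).2).mul
        (SpecializesTo.one.sub (ht0.mul ((hQz.pow (4 * i + 4)).div
        ((specializesTo_denom hQz hz (i := i)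
          (by have := Finset.mem_range.mp hi; omega)).1.pow 2)
        (pow_ne_zero 2 (specializesTo_denom hQz hz (i := i)
          (by have := Finset.mem_range.mp hi; omega)).2))))
    refine VanishesTo.prod_sub_prod hb hc fun i hi => ?_
    have hi' := Finset.mem_range.mp hi
    have hB := specializesTo_denom hQz hz (i := i) (by omega)
    have hD := specializesTo_middle hQz hz hi'
    have hd' := hd i hi'
    have h2 := hv.mul_specializesTo ((((hB.1.pow 2).sub ((hQz.pow (4 * i + 4)).mul ht0)).mul
      (((hQz.pow (4 * i + 2)).mul (hB.1.pow 3)).add hD.1)).neg.div ((hB.1.pow 3).mul hd')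
      (mul_ne_zero (pow_ne_zero 3 hB.2) (pow_ne_zero 3 hB.2)))
    convert h2 using 1
    have hB0 := hB.1.ne_zero hB.2
    have hd0 := hd'.ne_zero (pow_ne_zero 3 hB.2)
    generalize (x - 1) ^ 2 / x = t at *
    generalize (x - 1) ^ 3 = v at *
    generalize Q ^ (4 * i + 2) = D at *
    obtain ⟨b, hb⟩ : ∃ b, b = 1 - Q ^ (4 * i + 4) := ⟨_, rfl⟩
    obtain ⟨c, hc⟩ : ∃ c, c = (1 - Q ^ (4 * i + 4)) ^ 3 + v := ⟨_, rfl⟩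
    rw [← hc, ← hb]
    rw [← hc] at hd0
    rw [← hb] at hB0 hc
    generalize Q ^ (4 * i + 4) = B at *
    have hv' : v = c - b ^ 3 := by rw [hc]; ring
    rw [hv']
    field_simp
    ring
  have h2 := VanishesTo.prod_one_sub (N := N) ht (fun i hi =>
    (hQz.pow (4 * i + 4)).div ((specializesTo_denom hQz hz (i := i) (by omega)).1.pow 2)
      (pow_ne_zero 2 (specializesTo_denom hQz hz (i := i) (by omega)).2))
  rw [Finset.prod_mul_distrib] at h1
  have hh : SpecializesTo ζ (∏ i ∈ Finset.range N, ((1 - Q ^ (4 * i + 2)) / (1 - Q ^ (4 * i + 4))))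
      (∏ i ∈ Finset.range N, ((1 - z ^ (4 * i + 2)) / (1 - z ^ (4 * i + 4)))) := by
    refine SpecializesTo.prod fun i hi => ?_
    have hB := specializesTo_denom hQz hz (i := i) (by have := Finset.mem_range.mp hi; omega)
    exact (hQz.one_sub_pow _).div hB.1 hB.2
  have hN : SpecializesTo ζ (Q ^ N)⁻¹ (z ^ N)⁻¹ := (hQz.pow N).inv (pow_ne_zero _ hz0)
  have h3 := VanishesTo.specializesTo_mul (hN.mul hh)
    (((vanishesTo_one_sub_pow hQz hz.pow_eq_one).pow 2).mul (vanishesTo_harmonic hQz hz hx1))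
  have h4 := ((VanishesTo.specializesTo_mul hN h1).add
    ((VanishesTo.specializesTo_mul (hN.mul hh) h2).mono (by norm_num))).sub h3
  rw [e1, qShift_div_qShift, qInt_sq_mul_qB Q N hQ1]
  convert h4 using 1
  have e2 : (x - 1) ^ 2 / x = (1 - Q ^ (4 * N + 1)) ^ 2 * x := by
    rw [div_eq_iff hx0]
    linear_combination (x * Q ^ (4 * N + 1) - 2 * x + 1) * (-hx)
  rw [e2]
  ring

/-- The first congruence to order four, up to the factor `1 - Q`. -/
theorem sum_qRatio_approx (hQz : SpecializesTo ζ Q z) (hQ : ∀ j, 0 < j → Q ^ j ≠ 1)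
    (hz : IsPrimitiveRoot z (4 * N + 1)) :
    VanishesTo ζ 4 (∑ k ∈ Finset.range (N + 1),
        (1 - Q ^ (8 * k + 1)) * Q ^ (2 * k) * qRatio Q k ^ 4
      - (1 - Q ^ (4 * N + 1)) * ((Q ^ N)⁻¹
        * (qShift (Q ^ 2) (Q ^ 4) N / qShift (Q ^ 4) (Q ^ 4) N)
        * (1 + qInt Q (4 * N + 1) ^ 2 * qB (4 * N + 1) Q))) ∧
    (0 < N → VanishesTo ζ 4 (∑ k ∈ Finset.range (N + 1),
        (1 - Q ^ (8 * k + 1)) * Q ^ (2 * k) * qRatio Q k ^ 4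
          * ((Q ^ (4 * k))⁻¹ + Q ^ (4 * k + 1))
      - (1 - Q ^ (4 * N + 1)) * ((Q ^ N)⁻¹
        * (qShift (Q ^ 2) (Q ^ 4) N / qShift (Q ^ 4) (Q ^ 4) N)
        * (1 + qInt Q (4 * N + 1) ^ 2 * qB (4 * N + 1) Q)) * (4 * Q / (1 + Q)))) := by
  have hz0 : z ≠ 0 := hz.ne_zero (by omega)
  have hQ0 : Q ≠ 0 := hQz.ne_zero hz0
  have hQ1 : Q ≠ 1 := by simpa using hQ 1 one_pos
  obtain ⟨x, hx⟩ : ∃ x, x * Q ^ (4 * N + 1) = 1 := ⟨_, inv_mul_cancel₀ (pow_ne_zero _ hQ0)⟩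
  have hx1 : SpecializesTo ζ x 1 := by
    have := (hQz.pow (4 * N + 1)).inv (pow_ne_zero _ hz0)
    rwa [hz.pow_eq_one, inv_one, ← eq_inv_of_mul_eq_one_left hx] at this
  have hv : VanishesTo ζ 3 ((x - 1) ^ 3) := VanishesTo.pow (m := 1)
    (VanishesTo.of_specializesTo_zero (by simpa using hx1.sub SpecializesTo.one)) 3
  have hv0 := hv.specializesTo (by norm_num)
  have hne : ∀ i < N, (1 - Q ^ (4 * i + 4)) ^ 3 + (x - 1) ^ 3 ≠ 0 := fun i hi => by
    have hB := specializesTo_denom hQz hz (i := i) (by omega)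
    exact ((hB.1.pow 3).add hv0).ne_zero (by simpa using hB.2)
  have h1 := sum_deformed_sub hQz hz hv (fun _ => 1) (fun _ => 1)
    (fun _ _ => SpecializesTo.one) (fun _ _ => rfl)
  simp only [mul_one] at h1
  have h2 := (vanishesTo_one_sub_pow hQz hz.pow_eq_one).mul
    (prod_closed_form_approx hQz hQ0 hQ1 hz hx)
  have hS := sum_deformed_eq Q x N hQ0 hx hQ hne
  have h3 : VanishesTo ζ 4 (∑ k ∈ Finset.range (N + 1),
        (1 - Q ^ (8 * k + 1)) * Q ^ (2 * k) * deformedProd Q ((x - 1) ^ 3) k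
      - (1 - Q ^ (4 * N + 1)) * ((Q ^ N)⁻¹
        * (qShift (Q ^ 2) (Q ^ 4) N / qShift (Q ^ 4) (Q ^ 4) N)
        * (1 + qInt Q (4 * N + 1) ^ 2 * qB (4 * N + 1) Q))) := by
    rw [hS, ← mul_sub]
    exact h2
  refine ⟨?_, fun hN => ?_⟩
  · convert h3.sub h1 using 1
    ring
  have h4 := sum_deformed_sub hQz hz hv (fun k => (Q ^ (4 * k))⁻¹ + Q ^ (4 * k + 1))
    (fun k => (z ^ (4 * k))⁻¹ + z ^ (4 * k + 1))
    (fun k _ => ((hQz.pow _).inv (pow_ne_zero _ hz0)).add (hQz.pow _)) (fun k hk => by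
      have e1 : (z ^ (4 * (N - k)))⁻¹ = z ^ (4 * k + 1) := by
        apply inv_eq_of_mul_eq_one_right
        rw [← pow_add, ← hz.pow_eq_one]
        congr 1; omega
      have e2 : z ^ (4 * (N - k) + 1) = (z ^ (4 * k))⁻¹ := by
        apply eq_inv_of_mul_eq_one_left
        rw [← pow_add, ← hz.pow_eq_one]
        congr 1; omega
      rw [e1, e2, add_comm])
  have hW := sum_deformed_weighted Q x N hQ0 hN hx hQ hne
  have hSpec : SpecializesTo ζ (Q ^ 2 * (1 + (x - 1) ^ 3) - 1) (z ^ 2 - 1) := by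
    simpa using ((hQz.pow 2).mul (SpecializesTo.one.add hv0)).sub SpecializesTo.one
  have hz2 : z ^ 2 - 1 ≠ 0 := sub_ne_zero.mpr (hz.sq_ne_one hN)
  have hne2 := hSpec.ne_zero hz2
  have hz1 : 1 + z ≠ 0 := hz.one_add_ne_zero hN
  have hSpec1 : SpecializesTo ζ (1 + Q) (1 + z) := SpecializesTo.one.add hQz
  have hne1 := hSpec1.ne_zero hz1
  -- The deformed sum itself vanishes at ζ, because the undeformed one does by antisymmetry.
  have hSV : VanishesTo ζ 1 (∑ k ∈ Finset.range (N + 1),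
      (1 - Q ^ (8 * k + 1)) * Q ^ (2 * k) * deformedProd Q ((x - 1) ^ 3) k) := by
    have h5 := sum_wellPoised_eq_zero hz.pow_eq_one
      (fun j h1 h2 => hz.pow_four_mul_ne_one h1 (by omega)) (fun _ => 1) (fun _ _ => rfl)
    have h6 : SpecializesTo ζ (∑ k ∈ Finset.range (N + 1),
        (1 - Q ^ (8 * k + 1)) * Q ^ (2 * k) * qRatio Q k ^ 4) 0 := by
      rw [← h5]
      simp only [mul_one]
      refine SpecializesTo.sum fun k hk => ?_
      have hk' : k ≤ N := Nat.lt_succ_iff.mp (Finset.mem_range.mp hk)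
      exact ((hQz.one_sub_pow _).mul (hQz.pow _)).mul
        ((specializesTo_qRatio hQz hz (by omega)).pow 4)
    simpa using (h1.mono (show 1 ≤ 4 by norm_num)).add (VanishesTo.of_specializesTo_zero h6)
  -- The exact multiplier differs from 4Q/(1+Q) by vQ²(1-3Q)/((Q²(1+v)-1)(1+Q)); since v times the
  -- sum has order 3 + 1, this is negligible.
  have h7 := (hSV.mul hv).mul_specializesTo (((hQz.pow 2).mul
    (SpecializesTo.one.sub ((SpecializesTo.ofNat 3).mul hQz))).div (hSpec.mul hSpec1)
    (mul_ne_zero hz2 hz1))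
  have h8 := h3.mul_specializesTo
    (((SpecializesTo.ofNat 4).mul hQz).div hSpec1 hz1)
  rw [← eq_div_iff hne2] at hW
  simp only [hW] at h4
  convert (h7.add h8).sub h4 using 1
  generalize ∑ k ∈ Finset.range (N + 1),
    (1 - Q ^ (8 * k + 1)) * Q ^ (2 * k) * deformedProd Q ((x - 1) ^ 3) k = S
  generalize ∑ k ∈ Finset.range (N + 1), (1 - Q ^ (8 * k + 1)) * Q ^ (2 * k) * qRatio Q k ^ 4
    * ((Q ^ (4 * k))⁻¹ + Q ^ (4 * k + 1)) = S'
  have e : S * (x - 1) ^ 3 * (Q ^ 2 * (1 - 3 * Q) / ((Q ^ 2 * (1 + (x - 1) ^ 3) - 1) * (1 + Q)))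
      + S * (4 * Q / (1 + Q)) - (-4 * Q + 4 * Q ^ 2 + Q ^ 2 * (x - 1) ^ 3) * S
        / (Q ^ 2 * (1 + (x - 1) ^ 3) - 1) = 0 := by
    generalize (x - 1) ^ 3 = v at *
    obtain ⟨c, hc⟩ : ∃ c, c = Q ^ 2 * (1 + v) - 1 := ⟨_, rfl⟩
    obtain ⟨d, hd⟩ : ∃ d, d = 1 + Q := ⟨_, rfl⟩
    rw [← hc] at hne2 ⊢
    rw [← hd] at hne1 ⊢
    field_simp
    rw [hc, hd]
    ring
  linear_combination -e

end Congruence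

/-! ### Simple vanishing at roots of unity of order d dividing n. -/

theorem qInt_mul_one_sub {R : Type*} [CommRing R] (q : R) (n : ℕ) :
    qInt q n * (1 - q) = 1 - q ^ n := geom_sum_mul_neg q n

theorem IsPrimitiveRoot.pow_four_mul_ne_one_of_odd {F : Type*} [Field F] {z : F} {d j : ℕ}
    (hz : IsPrimitiveRoot z d) (hd : Odd d) (hj : 0 < j) (hjd : j < d) : z ^ (4 * j) ≠ 1 := by
  rw [Ne, hz.pow_eq_one_iff_dvd]
  intro h
  have hc : Nat.Coprime d 4 := Nat.Coprime.pow_right 2 hd.coprime_two_right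
  exact absurd (Nat.le_of_dvd hj (hc.dvd_of_dvd_mul_left h)) (by omega)

/-- `(Q^s;Q⁴)_k / (Q⁴;Q⁴)_k`. -/
def qRatioShift {K : Type*} [Field K] (s : ℕ) (Q : K) (k : ℕ) : K :=
  ∏ i ∈ Finset.range k, ((1 - Q ^ (4 * i + s)) / (1 - Q ^ (4 * i + 4)))

section Blocks

variable {ζ z : ℂ} {Q : RatFunc ℚ} {d : ℕ}

theorem specializesTo_one_sub_div_one_sub (hQz : SpecializesTo ζ Q z) (hz : z ^ d = 1)
    (hQ : Q ^ d ≠ 1) (a : ℕ) {b : ℕ} (hb : 0 < b) :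
    SpecializesTo ζ ((1 - Q ^ (d * a)) / (1 - Q ^ (d * b))) (a / b : ℂ) := by
  have hT : SpecializesTo ζ (Q ^ d) 1 := hz ▸ hQz.pow d
  have h := (hT.qInt a).div (hT.qInt b) (by simpa [qInt] using hb.ne')
  have h1 : 1 - Q ^ d ≠ 0 := sub_ne_zero.mpr hQ.symm
  rw [pow_mul, pow_mul, ← qInt_mul_one_sub (Q ^ d), ← qInt_mul_one_sub (Q ^ d), mul_div_mul_right _ _ h1]
  simpa [qInt] using h

theorem specializesTo_block (hQz : SpecializesTo ζ Q z) (hz : IsPrimitiveRoot z d) (hd : Odd d)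
    (s j : ℕ) {r : ℕ} (hr : r < d) :
    SpecializesTo ζ (∏ i ∈ Finset.range r,
      ((1 - Q ^ (4 * (d * j + i) + s)) / (1 - Q ^ (4 * (d * j + i) + 4)))) (qRatioShift s z r) := by
  have e : ∀ a b, z ^ (4 * (d * j + a) + b) = z ^ (4 * a + b) := by
    intro a b
    rw [show 4 * (d * j + a) + b = d * (4 * j) + (4 * a + b) by ring, pow_add, pow_mul,
      hz.pow_eq_one, one_pow, one_mul]
  refine SpecializesTo.prod fun i hi => ?_
  have hi' := Finset.mem_range.mp hi
  have h1 := hQz.one_sub_pow (4 * (d * j + i) + s)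
  have h2 := hQz.one_sub_pow (4 * (d * j + i) + 4)
  rw [e] at h1 h2
  exact h1.div h2 (sub_ne_zero.mpr (hz.pow_four_mul_ne_one_of_odd hd (j := i + 1) (by omega)
    (by omega)).symm)

/-- In a block of d consecutive factors, the only denominator vanishing at ζ is the last, with
exponent d(4j+4). It is paired with the numerator at i₀, whose exponent is d(4j+b), and the quotient
is regular. -/
theorem specializesTo_qRatioShift_mul (hQz : SpecializesTo ζ Q z) (hz : IsPrimitiveRoot z d)
    (hd : Odd d) (hQ : ∀ j, 0 < j → Q ^ j ≠ 1) {s i₀ b : ℕ} (hi₀ : i₀ < d)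
    (hs : 4 * i₀ + s = d * b) (j : ℕ) :
    ∃ y, SpecializesTo ζ (qRatioShift s Q (d * j)) y := by
  induction j with
  | zero => exact ⟨1, by simpa [qRatioShift] using SpecializesTo.one⟩
  | succ j ih =>
    obtain ⟨y, hy⟩ := ih
    have e : ∀ a b, z ^ (4 * (d * j + a) + b) = z ^ (4 * a + b) := by
      intro a b
      rw [show 4 * (d * j + a) + b = d * (4 * j) + (4 * a + b) by ring, pow_add, pow_mul,
        hz.pow_eq_one, one_pow, one_mul]
    have hd0 : 0 < d := by omega
    have h1 := specializesTo_one_sub_div_one_sub hQz hz.pow_eq_one (hQ d hd0) (4 * j + b)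
      (b := 4 * j + 4) (by omega)
    have h2 : SpecializesTo ζ (∏ i ∈ (Finset.range d).erase i₀, (1 - Q ^ (4 * (d * j + i) + s))) _ :=
      SpecializesTo.prod fun i _ => hQz.one_sub_pow _
    have h3 : SpecializesTo ζ (∏ i ∈ Finset.range (d - 1), (1 - Q ^ (4 * (d * j + i) + 4))) _ :=
      SpecializesTo.prod fun i _ => hQz.one_sub_pow _
    have h4 : ∏ i ∈ Finset.range (d - 1), (1 - z ^ (4 * (d * j + i) + 4)) ≠ 0 := by
      refine Finset.prod_ne_zero_iff.mpr fun i hi => ?_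
      have hi' := Finset.mem_range.mp hi
      rw [e]
      exact sub_ne_zero.mpr (hz.pow_four_mul_ne_one_of_odd hd (j := i + 1) (by omega)
        (by omega)).symm
    have key : qRatioShift s Q (d * (j + 1)) = qRatioShift s Q (d * j)
        * ((1 - Q ^ (d * (4 * j + b))) / (1 - Q ^ (d * (4 * j + 4)))
          * ((∏ i ∈ (Finset.range d).erase i₀, (1 - Q ^ (4 * (d * j + i) + s)))
            / ∏ i ∈ Finset.range (d - 1), (1 - Q ^ (4 * (d * j + i) + 4)))) := by
      rw [qRatioShift, qRatioShift, mul_add, mul_one, Finset.prod_range_add]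
      congr 1
      have hden : ∏ i ∈ Finset.range d, (1 - Q ^ (4 * (d * j + i) + 4))
          = (∏ i ∈ Finset.range (d - 1), (1 - Q ^ (4 * (d * j + i) + 4)))
            * (1 - Q ^ (d * (4 * j + 4))) := by
        obtain ⟨c, rfl⟩ : ∃ c, d = c + 1 := ⟨d - 1, by omega⟩
        rw [Finset.prod_range_succ, Nat.add_sub_cancel]
        congr 3
        ring
      rw [Finset.prod_div_distrib, ← Finset.mul_prod_erase _ _ (Finset.mem_range.mpr hi₀), hden,
        show 4 * (d * j + i₀) + s = d * (4 * j + b) by rw [mul_add d, ← hs]; ring,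
        mul_comm (∏ i ∈ Finset.range (d - 1), _), mul_div_mul_comm]
    rw [key]
    exact ⟨_, hy.mul (h1.mul (h2.div h3 h4))⟩

theorem qRatioShift_block {K : Type*} [Field K] (s : ℕ) (Q : K) (m r : ℕ) :
    qRatioShift s Q (m + r) = qRatioShift s Q m * ∏ i ∈ Finset.range r,
      ((1 - Q ^ (4 * (m + i) + s)) / (1 - Q ^ (4 * (m + i) + 4))) := Finset.prod_range_add _ _ _

theorem specializesTo_qRatioShift (hQz : SpecializesTo ζ Q z) (hz : IsPrimitiveRoot z d)
    (hd : Odd d) (hQ : ∀ j, 0 < j → Q ^ j ≠ 1) {s i₀ b : ℕ} (hi₀ : i₀ < d)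
    (hs : 4 * i₀ + s = d * b) (k : ℕ) :
    ∃ y, SpecializesTo ζ (qRatioShift s Q k) y := by
  obtain ⟨y, hy⟩ := specializesTo_qRatioShift_mul hQz hz hd hQ hi₀ hs (k / d)
  have h := specializesTo_block hQz hz hd s (k / d) (Nat.mod_lt k (by omega))
  rw [← Nat.div_add_mod k d, qRatioShift_block]
  exact ⟨_, hy.mul h⟩

/-- A partial sum of the series over full blocks of length `d`, and possibly the first part of a
further block, vanishes at `ζ`. -/
theorem vanishesTo_block_sums (hQz : SpecializesTo ζ Q z) (hz : IsPrimitiveRoot z d)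
    (hd : Odd d) (hQ : ∀ j, 0 < j → Q ^ j ≠ 1) {m l : ℕ} (hmd : m < d) (hm : 4 * m + 1 = d * l)
    (W : ℕ → RatFunc ℚ) (w : ℕ → ℂ) (hW : ∀ k, SpecializesTo ζ (W k) (w k))
    (hp : ∀ j r, w (d * j + r) = w r) (hw : ∀ k ≤ m, w (m - k) = w k) (j : ℕ) :
    VanishesTo ζ 1 (∑ k ∈ Finset.range (d * j),
      (1 - Q ^ (8 * k + 1)) * Q ^ (2 * k) * qRatio Q k ^ 4 * W k) ∧
    VanishesTo ζ 1 (∑ k ∈ Finset.range (d * j + (m + 1)),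
      (1 - Q ^ (8 * k + 1)) * Q ^ (2 * k) * qRatio Q k ^ 4 * W k) := by
  have hzm : z ^ (4 * m + 1) = 1 := by rw [hm, pow_mul, hz.pow_eq_one, one_pow]
  have h4 : ∀ j, 0 < j → j ≤ m → z ^ (4 * j) ≠ 1 :=
    fun j h1 h2 => hz.pow_four_mul_ne_one_of_odd hd h1 (by omega)
  have hterm : ∀ j R, R ≤ d → ∃ y : ℂ, SpecializesTo ζ (∑ r ∈ Finset.range R,
      (1 - Q ^ (8 * (d * j + r) + 1)) * Q ^ (2 * (d * j + r)) * qRatio Q (d * j + r) ^ 4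
        * W (d * j + r))
      (y * ∑ r ∈ Finset.range R, (1 - z ^ (8 * r + 1)) * z ^ (2 * r) * qRatio z r ^ 4 * w r) := by
    intro j R hR
    obtain ⟨y, hy⟩ := specializesTo_qRatioShift_mul hQz hz hd hQ hmd hm j
    refine ⟨y ^ 4, ?_⟩
    rw [Finset.mul_sum]
    refine SpecializesTo.sum fun r hr => ?_
    have hr' := Finset.mem_range.mp hr
    have h1 := hy.mul (specializesTo_block hQz hz hd 1 j (r := r) (by omega))
    rw [← qRatioShift_block] at h1
    change SpecializesTo ζ (qRatio Q (d * j + r)) (y * qRatio z r) at h1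
    have h2 := hQz.one_sub_pow (8 * (d * j + r) + 1)
    have h3 := hQz.pow (2 * (d * j + r))
    rw [show 8 * (d * j + r) + 1 = d * (8 * j) + (8 * r + 1) by ring, pow_add z, pow_mul,
      hz.pow_eq_one, one_pow, one_mul, ← show 8 * (d * j + r) + 1 = d * (8 * j) + (8 * r + 1) by
      ring] at h2
    rw [show 2 * (d * j + r) = d * (2 * j) + 2 * r by ring, pow_add z, pow_mul,
      hz.pow_eq_one, one_pow, one_mul, ← show 2 * (d * j + r) = d * (2 * j) + 2 * r by
      ring] at h3
    have h5 := hW (d * j + r)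
    rw [hp] at h5
    convert ((h2.mul h3).mul (h1.pow 4)).mul h5 using 1
    ring
  have hpart : ∑ r ∈ Finset.range (m + 1),
      (1 - z ^ (8 * r + 1)) * z ^ (2 * r) * qRatio z r ^ 4 * w r = 0 :=
    sum_wellPoised_eq_zero hzm h4 w hw
  -- Beyond r = m every term contains the factor 1 - z^(4m+1) = 0, so a full block has the same
  -- value as its initial part.
  have hfull : ∑ r ∈ Finset.range d,
      (1 - z ^ (8 * r + 1)) * z ^ (2 * r) * qRatio z r ^ 4 * w r = 0 := by
    rw [← hpart]
    symm
    refine Finset.sum_subset (Finset.range_mono (by omega)) fun r _ hr => ?_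
    have h1 : qRatio z r = 0 :=
      Finset.prod_eq_zero (i := m) (Finset.mem_range.mpr (by
        rw [Finset.mem_range, not_lt] at hr; omega)) (by rw [hzm]; simp)
    rw [h1]
    ring
  have hblocks : ∀ j, VanishesTo ζ 1 (∑ k ∈ Finset.range (d * j),
      (1 - Q ^ (8 * k + 1)) * Q ^ (2 * k) * qRatio Q k ^ 4 * W k) := by
    intro j
    induction j with
    | zero => simpa using VanishesTo.zero
    | succ j ih =>
      rw [mul_add, mul_one, Finset.sum_range_add]
      refine ih.add ?_
      obtain ⟨y, hy⟩ := hterm j d le_rfl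
      rw [hfull, mul_zero] at hy
      exact VanishesTo.of_specializesTo_zero hy
  refine ⟨hblocks j, ?_⟩
  rw [Finset.sum_range_add]
  refine (hblocks j).add ?_
  obtain ⟨y, hy⟩ := hterm j (m + 1) (by omega)
  rw [hpart, mul_zero] at hy
  exact VanishesTo.of_specializesTo_zero hy

/-- From de ≡ 1 modulo 4 the factors are both 1 or both 3 modulo 4; accordingly m is (d-1)/4 or
(3d-1)/4. -/
theorem exists_block_decomposition {d e N : ℕ} (h : 4 * N + 1 = d * e) :
    ∃ m l j, m < d ∧ 4 * m + 1 = d * l ∧ N = d * j + m := by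
  have h4 : d * e % 4 = 1 := by omega
  rw [Nat.mul_mod] at h4
  have hd : d % 4 < 4 := Nat.mod_lt _ (by norm_num)
  have he : e % 4 < 4 := Nat.mod_lt _ (by norm_num)
  have : (d % 4 = 1 ∧ e % 4 = 1) ∨ (d % 4 = 3 ∧ e % 4 = 3) := by
    generalize d % 4 = a at *
    generalize e % 4 = b at *
    interval_cases a <;> interval_cases b <;> simp_all
  rcases this with ⟨h1, h2⟩ | ⟨h1, h2⟩
  · refine ⟨d / 4, 1, e / 4, by omega, by omega, ?_⟩
    have : d * e = d * (4 * (e / 4) + 1) := by congr 1; omega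
    rw [mul_add, mul_left_comm] at this
    omega
  · refine ⟨3 * (d / 4) + 2, 3, e / 4, by omega, by omega, ?_⟩
    have : d * e = d * (4 * (e / 4) + 3) := by congr 1; omega
    rw [mul_add, mul_left_comm] at this
    omega

/-- Both truncations of the series vanish at `ζ`. -/
theorem vanishesTo_sum (hQz : SpecializesTo ζ Q z) (hz : IsPrimitiveRoot z d)
    (hQ : ∀ j, 0 < j → Q ^ j ≠ 1) {N M : ℕ} (hM : M = N ∨ M = 4 * N) (hdN : d ∣ 4 * N + 1)
    (W : ℕ → RatFunc ℚ) (w : ℕ → ℂ) (hW : ∀ k, SpecializesTo ζ (W k) (w k))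
    (hp : ∀ j r, w (d * j + r) = w r)
    (hw : ∀ k m, d ∣ 4 * m + 1 → k ≤ m → w (m - k) = w k) :
    VanishesTo ζ 1 (∑ k ∈ Finset.range (M + 1),
      (1 - Q ^ (8 * k + 1)) * Q ^ (2 * k) * qRatio Q k ^ 4 * W k) := by
  obtain ⟨e, he⟩ := hdN
  have hd : Odd d := by
    have : Odd (4 * N + 1) := ⟨2 * N, by ring⟩
    rw [he] at this
    exact (Nat.odd_mul.mp this).1
  obtain ⟨m, l, j, hmd, hm, hN⟩ := exists_block_decomposition he
  rcases hM with rfl | rfl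
  · rw [hN, add_assoc]
    exact (vanishesTo_block_sums hQz hz hd hQ hmd hm W w hW hp
      (fun k hk => hw k m ⟨l, hm⟩ hk) j).2
  · rw [he]
    exact (vanishesTo_block_sums hQz hz hd hQ hmd hm W w hW hp
      (fun k hk => hw k m ⟨l, hm⟩ hk) e).1

/-- The right-hand side vanishes at `ζ`. -/
theorem vanishesTo_closed_form (hQz : SpecializesTo ζ Q z) (hz : IsPrimitiveRoot z d)
    (hQ : ∀ j, 0 < j → Q ^ j ≠ 1) {N : ℕ} (hdN : d ∣ 4 * N + 1) :
    VanishesTo ζ 1 ((1 - Q ^ (4 * N + 1)) * ((Q ^ N)⁻¹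
        * (qShift (Q ^ 2) (Q ^ 4) N / qShift (Q ^ 4) (Q ^ 4) N)
        * (1 + qInt Q (4 * N + 1) ^ 2 * qB (4 * N + 1) Q))) := by
  obtain ⟨e, he⟩ := hdN
  have hd : Odd d := by
    have : Odd (4 * N + 1) := ⟨2 * N, by ring⟩
    rw [he] at this
    exact (Nat.odd_mul.mp this).1
  have hd0 : 0 < d := hd.pos
  have hz0 : z ≠ 0 := hz.ne_zero (by omega)
  have hzn : z ^ (4 * N + 1) = 1 := by rw [he, pow_mul, hz.pow_eq_one, one_pow]
  have hQ1 : Q ≠ 1 := by simpa using hQ 1 one_pos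
  have h1 : ∃ y, SpecializesTo ζ (qShift (Q ^ 2) (Q ^ 4) N / qShift (Q ^ 4) (Q ^ 4) N) y := by
    rw [qShift_div_qShift]
    obtain ⟨c, hc⟩ := hd
    -- For d = 2c + 1 the vanishing numerator sits at i₀ = c, since 4c + 2 = 2d.
    exact specializesTo_qRatioShift hQz hz ⟨c, hc⟩ hQ (s := 2) (i₀ := c) (b := 2) (by omega)
      (by omega) N
  -- The terms of B may have poles at ζ when d < n; the square of 1 - Q^n cancels them.
  have h2 : ∀ i, ∃ y, SpecializesTo ζ ((1 - Q ^ (4 * N + 1)) / (1 - Q ^ (4 * i + 2))) y := by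
    intro i
    by_cases hi : d ∣ 4 * i + 2
    · obtain ⟨f, hf⟩ := hi
      rw [he, hf]
      have hf0 : 0 < f := by
        rcases Nat.eq_zero_or_pos f with rfl | h
        · omega
        · exact h
      exact ⟨_, specializesTo_one_sub_div_one_sub hQz hz.pow_eq_one (hQ d hd0) e hf0⟩
    · exact ⟨_, (hQz.one_sub_pow _).div (hQz.one_sub_pow _) (sub_ne_zero.mpr
        (fun h => hi ((hz.pow_eq_one_iff_dvd _).mp h.symm)))⟩
  choose y2 h2 using h2
  obtain ⟨y1, h1⟩ := h1
  have h3 : SpecializesTo ζ (∑ i ∈ Finset.range N, Q ^ (4 * i + 2)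
      * ((1 - Q ^ (4 * N + 1)) / (1 - Q ^ (4 * i + 2))) ^ 2) _ :=
    SpecializesTo.sum fun i _ => (hQz.pow (4 * i + 2)).mul ((h2 i).pow 2)
  have h4 := ((((((SpecializesTo.ofNat (ζ := ζ) 4).mul (SpecializesTo.natCast N)).add
    SpecializesTo.one).pow 2).sub SpecializesTo.one).div (SpecializesTo.ofNat 24)
    (by norm_num)).mul ((hQz.one_sub_pow (4 * N + 1)).pow 2)
  have h5 := h4.add h3
  have key : qInt Q (4 * N + 1) ^ 2 * qB (4 * N + 1) Q
      = ((4 * (N : RatFunc ℚ) + 1) ^ 2 - 1) / 24 * (1 - Q ^ (4 * N + 1)) ^ 2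
        + ∑ i ∈ Finset.range N, Q ^ (4 * i + 2)
          * ((1 - Q ^ (4 * N + 1)) / (1 - Q ^ (4 * i + 2))) ^ 2 := by
    rw [qInt_sq_mul_qB Q N hQ1, mul_add, Finset.mul_sum, mul_comm]
    congr 1
    refine Finset.sum_congr rfl fun i _ => ?_
    rw [div_pow]
    ring
  rw [key]
  exact (vanishesTo_one_sub_pow hQz hzn).mul_specializesTo
    ((((hQz.pow N).inv (pow_ne_zero _ hz0)).mul h1).mul (SpecializesTo.one.add h5))

end Blocks

/-! ### Gluing the local statements and conclusion. -/

theorem qModulus_eq {n : ℕ} (hn : 1 < n) :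
    qModulus n = cyclotomic n ℚ ^ 4 * ∏ d ∈ (n.divisors.erase 1).erase n, cyclotomic d ℚ := by
  have h1 : qInt (X : ℚ[X]) n = ∏ d ∈ n.divisors.erase 1, cyclotomic d ℚ :=
    (prod_cyclotomic_eq_geom_sum (by omega) ℚ).symm
  rw [qModulus, h1, ← Finset.mul_prod_erase (n.divisors.erase 1) _
    (Finset.mem_erase.mpr ⟨by omega, Nat.mem_divisors_self n (by omega)⟩)]
  ring

/-- Congruences modulo `[n] Φ_n(q)³` can be checked at roots of unity. -/
theorem qCong_of_vanishesTo {n : ℕ} (hn : 1 < n) {A B : RatFunc ℚ}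
    (h4 : ∀ ζ : ℂ, IsPrimitiveRoot ζ n → VanishesTo ζ 4 (A - B))
    (h1 : ∀ d, d ∣ n → 1 < d → ∀ ζ : ℂ, IsPrimitiveRoot ζ d → VanishesTo ζ 1 (A - B)) :
    QCong (qModulus n) A B := by
  -- One primitive d-th root is enough, as its minimal polynomial over ℚ is Φ_d.
  have key : ∀ d m, 0 < d → (∀ ζ : ℂ, IsPrimitiveRoot ζ d → VanishesTo ζ m (A - B)) →
      cyclotomic d ℚ ^ m ∣ (A - B).num := by
    intro d m hd h
    have hζ := Complex.isPrimitiveRoot_exp d hd.ne'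
    rw [cyclotomic_eq_minpoly_rat hζ hd]
    exact (h _ hζ).pow_dvd_num ((hζ.isIntegral hd).tower_top)
  rw [QCong, qModulus_eq hn]
  refine IsCoprime.mul_dvd ?_ (key n 4 (by omega) h4) (Finset.prod_dvd_of_coprime ?_ ?_)
  · refine IsCoprime.pow_left (IsCoprime.prod_right fun d hd => ?_)
    exact cyclotomic.isCoprime_rat (Finset.ne_of_mem_erase hd).symm
  · intro i _ j _ hij
    exact cyclotomic.isCoprime_rat hij
  · intro d hd
    obtain ⟨-, hd1, hd⟩ : d ≠ n ∧ d ≠ 1 ∧ d ∈ n.divisors := by simpa using hd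
    have hdn := Nat.dvd_of_mem_divisors hd
    have hd0 : 0 < d := Nat.pos_of_mem_divisors hd
    simpa using key d 1 hd0 (h1 d hdn (by omega))

theorem RatFunc.X_pow_ne_one {j : ℕ} (hj : 0 < j) : (RatFunc.X : RatFunc ℚ) ^ j ≠ 1 := by
  intro h
  rw [← RatFunc.algebraMap_X, ← map_pow, ← map_one (algebraMap ℚ[X] (RatFunc ℚ))] at h
  have h1 := congrArg natDegree (RatFunc.algebraMap_injective ℚ h)
  rw [natDegree_X_pow, natDegree_one] at h1
  omega

/-- Each term with k > N contains the fourth power of a factor vanishing at ζ, so both truncations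
agree to order four. -/
theorem vanishesTo_sum_tail {ζ z : ℂ} {Q : RatFunc ℚ} {N M : ℕ} (hQz : SpecializesTo ζ Q z)
    (hz : IsPrimitiveRoot z (4 * N + 1)) (hM : M = N ∨ M = 4 * N)
    (W : ℕ → RatFunc ℚ) (w : ℕ → ℂ) (hW : ∀ k, SpecializesTo ζ (W k) (w k)) :
    VanishesTo ζ 4 (∑ k ∈ Finset.range (M + 1),
        (1 - Q ^ (8 * k + 1)) * Q ^ (2 * k) * qRatio Q k ^ 4 * W k
      - ∑ k ∈ Finset.range (N + 1),
        (1 - Q ^ (8 * k + 1)) * Q ^ (2 * k) * qRatio Q k ^ 4 * W k) := by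
  rcases hM with rfl | rfl
  · rw [sub_self]
    exact VanishesTo.zero
  · rw [show 4 * N + 1 = N + 1 + 3 * N by ring, Finset.sum_range_add, add_sub_cancel_left]
    refine VanishesTo.sum fun i hi => ?_
    have hi' := Finset.mem_range.mp hi
    have h := specializesTo_qRatio hQz hz (k := N + 1 + i) (by omega)
    have h0 : qRatio z (N + 1 + i) = 0 :=
      Finset.prod_eq_zero (i := N) (Finset.mem_range.mpr (by omega)) (by
        rw [hz.pow_eq_one]; simp)
    rw [h0] at h
    exact (VanishesTo.specializesTo_mul ((hQz.one_sub_pow _).mul (hQz.pow _))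
      ((VanishesTo.of_specializesTo_zero h).pow 4)).mul_specializesTo (hW _)

theorem first_sum_eq {K : Type*} [Field K] (Q : K) (hQ : Q ≠ 1) (N M : ℕ) :
    (∑ k ∈ Finset.range (M + 1),
        qInt Q (8 * k + 1) * (qShift Q (Q ^ 4) k ^ 4 / qShift (Q ^ 4) (Q ^ 4) k ^ 4) * Q ^ (2 * k))
      - qShift (Q ^ 2) (Q ^ 4) N / qShift (Q ^ 4) (Q ^ 4) N
        * qInt Q (4 * N + 1) * Q ^ (-(N : ℤ))
        * (1 + qInt Q (4 * N + 1) ^ 2 * qB (4 * N + 1) Q)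
    = (∑ k ∈ Finset.range (M + 1),
        (1 - Q ^ (8 * k + 1)) * Q ^ (2 * k) * qRatio Q k ^ 4
      - (1 - Q ^ (4 * N + 1)) * ((Q ^ N)⁻¹
        * (qShift (Q ^ 2) (Q ^ 4) N / qShift (Q ^ 4) (Q ^ 4) N)
        * (1 + qInt Q (4 * N + 1) ^ 2 * qB (4 * N + 1) Q))) * (1 - Q)⁻¹ := by
  rw [sub_mul, Finset.sum_mul]
  congr 1
  · refine Finset.sum_congr rfl fun k _ => ?_
    have := qShift_div_qShift Q 1 k
    rw [pow_one] at this
    rw [← div_pow, this, qInt_eq_div Q hQ, qRatio]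
    ring
  · rw [zpow_neg, zpow_natCast]
    generalize 1 + qInt Q (4 * N + 1) ^ 2 * qB (4 * N + 1) Q = t
    rw [qInt_eq_div Q hQ]
    ring

/-- Expanding (1-q^(8k+1))² makes the second series the weighted series in q² minus 2q times the
first. On the right, 4q²/(1+q²) - 2q = -2q(1-q)²/(1+q²) supplies the sign and the factor (1-q)². -/
theorem second_sum_eq {K : Type*} [Field K] (q : K) (hq : q ^ 2 ≠ 1) (hq0 : q ≠ 0)
    (hq1 : 1 + q ^ 2 ≠ 0) (N M : ℕ) :
    (∑ k ∈ Finset.range (M + 1),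
          qInt (q ^ 2) (8 * k + 1) * qInt q (8 * k + 1) ^ 2
            * (qShift (q ^ 2) (q ^ 8) k ^ 4 / qShift (q ^ 8) (q ^ 8) k ^ 4)
            * q ^ (-4 * (k : ℤ)))
      - (-(2 * qInt (q ^ 2) (4 * N + 1) * qShift (q ^ 4) (q ^ 8) N
              / ((1 + q ^ 2) * qShift (q ^ 8) (q ^ 8) N))
          * q ^ (1 - 2 * (N : ℤ)) * (1 + qInt (q ^ 2) (4 * N + 1) ^ 2 * qB (4 * N + 1) (q ^ 2)))
    = (∑ k ∈ Finset.range (M + 1),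
        (1 - (q ^ 2) ^ (8 * k + 1)) * (q ^ 2) ^ (2 * k) * qRatio (q ^ 2) k ^ 4
          * (((q ^ 2) ^ (4 * k))⁻¹ + (q ^ 2) ^ (4 * k + 1) - 2 * q)
      - (1 - (q ^ 2) ^ (4 * N + 1)) * (((q ^ 2) ^ N)⁻¹
        * (qShift ((q ^ 2) ^ 2) ((q ^ 2) ^ 4) N / qShift ((q ^ 2) ^ 4) ((q ^ 2) ^ 4) N)
        * (1 + qInt (q ^ 2) (4 * N + 1) ^ 2 * qB (4 * N + 1) (q ^ 2)))
        * (4 * q ^ 2 / (1 + q ^ 2) - 2 * q)) * ((1 - q ^ 2) * (1 - q) ^ 2)⁻¹ := by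
  have hq2 : q ≠ 1 := by rintro rfl; simp at hq
  have h1 : 1 - q ≠ 0 := sub_ne_zero.mpr hq2.symm
  have h2 : 1 - q ^ 2 ≠ 0 := sub_ne_zero.mpr hq.symm
  rw [sub_mul, Finset.sum_mul]
  congr 1
  · refine Finset.sum_congr rfl fun k _ => ?_
    have := qShift_div_qShift (q ^ 2) 1 k
    rw [pow_one, ← pow_mul q 2 4] at this
    change _ = qRatio (q ^ 2) k at this
    rw [← div_pow, this, qInt_eq_div q hq2, qInt_eq_div (q ^ 2) hq]
    have e1 : q ^ (-4 * (k : ℤ)) = (q ^ (4 * k))⁻¹ := by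
      rw [← zpow_natCast, ← zpow_neg]; congr 1
    have e2 : (q ^ 2) ^ (2 * k) * (((q ^ 2) ^ (4 * k))⁻¹ + (q ^ 2) ^ (4 * k + 1) - 2 * q)
        = (1 - q ^ (8 * k + 1)) ^ 2 * (q ^ (4 * k))⁻¹ := by
      have h3 : q ^ k ≠ 0 := pow_ne_zero _ hq0
      rw [show (q ^ 2) ^ (2 * k) = (q ^ k) ^ 4 by ring, show (q ^ 2) ^ (4 * k) = (q ^ k) ^ 8 by ring,
        show (q ^ 2) ^ (4 * k + 1) = q ^ 2 * (q ^ k) ^ 8 by ring,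
        show q ^ (8 * k + 1) = q * (q ^ k) ^ 8 by ring, show q ^ (4 * k) = (q ^ k) ^ 4 by ring]
      generalize q ^ k = y at *
      field_simp
      ring
    generalize qRatio (q ^ 2) k = g
    rw [e1, show (1 - (q ^ 2) ^ (8 * k + 1)) * (q ^ 2) ^ (2 * k) * g ^ 4
      * (((q ^ 2) ^ (4 * k))⁻¹ + (q ^ 2) ^ (4 * k + 1) - 2 * q)
      = (1 - (q ^ 2) ^ (8 * k + 1)) * g ^ 4 * ((q ^ 2) ^ (2 * k)
      * (((q ^ 2) ^ (4 * k))⁻¹ + (q ^ 2) ^ (4 * k + 1) - 2 * q)) by ring, e2]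
    rw [mul_inv, div_pow]
    simp only [div_eq_mul_inv]
    generalize ((1 - q) ^ 2)⁻¹ = u
    ring
  · have e1 : q ^ (1 - 2 * (N : ℤ)) = q * ((q ^ 2) ^ N)⁻¹ := by
      rw [zpow_sub₀ hq0, zpow_one, ← pow_mul, ← zpow_natCast, div_eq_mul_inv]
      push_cast
      rfl
    generalize 1 + qInt (q ^ 2) (4 * N + 1) ^ 2 * qB (4 * N + 1) (q ^ 2) = t
    rw [e1, qInt_eq_div (q ^ 2) hq, ← pow_mul q 2 4, ← pow_mul q 2 2]
    have e2 : 4 * q ^ 2 / (1 + q ^ 2) - 2 * q = -(2 * q * (1 - q) ^ 2 / (1 + q ^ 2)) := by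
      field_simp
      ring
    have e3 : ((1 - q) ^ 2) * ((1 - q) ^ 2)⁻¹ = 1 := mul_inv_cancel₀ (pow_ne_zero _ h1)
    rw [e2, mul_inv]
    simp only [div_eq_mul_inv, mul_inv, Nat.reduceMul]
    linear_combination (-(2 * (1 - (q ^ 2) ^ (4 * N + 1)) * (1 - q ^ 2)⁻¹
      * qShift (q ^ 4) (q ^ 8) N * (1 + q ^ 2)⁻¹ * (qShift (q ^ 8) (q ^ 8) N)⁻¹ * q
      * ((q ^ 2) ^ N)⁻¹ * t)) * (-e3)

theorem weight_periodic {F : Type*} [Field F] {z : F} {d : ℕ} (hz : z ^ d = 1) (c : F) (j r : ℕ) :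
    (z ^ (4 * (d * j + r)))⁻¹ + z ^ (4 * (d * j + r) + 1) - c
      = (z ^ (4 * r))⁻¹ + z ^ (4 * r + 1) - c := by
  have : z ^ (4 * (d * j + r)) = z ^ (4 * r) := by
    rw [show 4 * (d * j + r) = d * (4 * j) + 4 * r by ring, pow_add, pow_mul, hz, one_pow, one_mul]
  rw [pow_succ, this, pow_succ]

theorem weight_reflect {F : Type*} [Field F] {z : F} {m k : ℕ} (hz : z ^ (4 * m + 1) = 1) (c : F)
    (hk : k ≤ m) :
    (z ^ (4 * (m - k)))⁻¹ + z ^ (4 * (m - k) + 1) - c = (z ^ (4 * k))⁻¹ + z ^ (4 * k + 1) - c := by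
  have e1 : (z ^ (4 * (m - k)))⁻¹ = z ^ (4 * k + 1) := by
    apply inv_eq_of_mul_eq_one_right
    rw [← pow_add, ← hz]
    congr 1; omega
  have e2 : z ^ (4 * (m - k) + 1) = (z ^ (4 * k))⁻¹ := by
    apply eq_inv_of_mul_eq_one_left
    rw [← pow_add, ← hz]
    congr 1; omega
  rw [e1, e2, add_comm]

theorem theorem1 (n : ℕ) (hn : n ≡ 1 [MOD 4]) (M : ℕ) (hM : M = (n - 1) / 4 ∨ M = n - 1)
    (q : RatFunc ℚ) (hq : q = RatFunc.X) :
    QCong (qModulus n)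
      (∑ k ∈ Finset.range (M + 1),
        qInt q (8 * k + 1) * (qShift q (q ^ 4) k ^ 4 / qShift (q ^ 4) (q ^ 4) k ^ 4) * q ^ (2 * k))
      (qShift (q ^ 2) (q ^ 4) ((n - 1) / 4) / qShift (q ^ 4) (q ^ 4) ((n - 1) / 4)
        * qInt q n * q ^ ((1 - (n : ℤ)) / 4) * (1 + qInt q n ^ 2 * qB n q))
    ∧ (1 < n →
      QCong (qModulus n)
        (∑ k ∈ Finset.range (M + 1),
          qInt (q ^ 2) (8 * k + 1) * qInt q (8 * k + 1) ^ 2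
            * (qShift (q ^ 2) (q ^ 8) k ^ 4 / qShift (q ^ 8) (q ^ 8) k ^ 4)
            * q ^ (-4 * (k : ℤ)))
        (-(2 * qInt (q ^ 2) n * qShift (q ^ 4) (q ^ 8) ((n - 1) / 4)
              / ((1 + q ^ 2) * qShift (q ^ 8) (q ^ 8) ((n - 1) / 4)))
          * q ^ ((3 - (n : ℤ)) / 2) * (1 + qInt (q ^ 2) n ^ 2 * qB n (q ^ 2)))) := by
  obtain ⟨N, rfl⟩ : ∃ N, n = 4 * N + 1 := by
    have h : n % 4 = 1 := hn
    exact ⟨n / 4, by omega⟩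
  have hN4 : (4 * N + 1 - 1) / 4 = N := by omega
  have hz1 : (1 - ((4 * N + 1 : ℕ) : ℤ)) / 4 = -(N : ℤ) := by omega
  have hz2 : (3 - ((4 * N + 1 : ℕ) : ℤ)) / 2 = 1 - 2 * (N : ℤ) := by omega
  rw [hN4, Nat.add_sub_cancel] at hM
  rw [hN4, hz1, hz2]
  have hqX : ∀ j, 0 < j → q ^ j ≠ 1 := fun j hj => hq ▸ RatFunc.X_pow_ne_one hj
  have hq2X : ∀ j, 0 < j → (q ^ 2) ^ j ≠ 1 := fun j hj => by
    rw [← pow_mul]; exact hqX _ (by omega)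
  have hq1 : q ≠ 1 := by simpa using hqX 1 one_pos
  have hq0 : q ≠ 0 := hq ▸ RatFunc.X_ne_zero
  have hqζ : ∀ ζ : ℂ, SpecializesTo ζ q ζ := fun ζ => hq ▸ SpecializesTo.X
  have hodd : Odd (4 * N + 1) := ⟨2 * N, by ring⟩
  -- For n = 1 the modulus is (q-1)³, which is not covered by the root-of-unity criterion, but the
  -- two sides are equal.
  rcases Nat.eq_zero_or_pos N with rfl | hN
  · obtain rfl : M = 0 := by omega
    refine ⟨?_, fun h => absurd h (by norm_num)⟩
    have : qB 1 q = 0 := by simp [qB]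
    simp [QCong, qInt, qShift, this]
  refine ⟨?_, fun _ => ?_⟩
  · have h1sub : ∀ d, 1 < d → ∀ ζ : ℂ, IsPrimitiveRoot ζ d →
        SpecializesTo ζ (1 - q)⁻¹ (1 - ζ)⁻¹ := fun d hd ζ hζ =>
      (SpecializesTo.one.sub (hqζ ζ)).inv (sub_ne_zero.mpr (hζ.ne_one hd).symm)
    refine qCong_of_vanishesTo (by omega) (fun ζ hζ => ?_) fun d hdn hd ζ hζ => ?_
    · rw [first_sum_eq q hq1]
      refine VanishesTo.mul_specializesTo ?_ (h1sub _ (by omega) ζ hζ)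
      have h := (vanishesTo_sum_tail (hqζ ζ) hζ hM (fun _ => 1) (fun _ => 1)
        (fun _ => SpecializesTo.one)).add
        (by simpa only [mul_one] using (sum_qRatio_approx (hqζ ζ) hqX hζ).1)
      simpa only [mul_one, sub_add_sub_cancel] using h
    · rw [first_sum_eq q hq1]
      refine VanishesTo.mul_specializesTo ?_ (h1sub _ hd ζ hζ)
      refine VanishesTo.sub ?_ (vanishesTo_closed_form (hqζ ζ) hζ hqX hdn)
      simpa only [mul_one] using vanishesTo_sum (hqζ ζ) hζ hqX hM hdn (fun _ => 1) (fun _ => 1)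
        (fun _ => SpecializesTo.one) (fun _ _ => rfl) (fun _ _ _ _ => rfl)
  · have hprim : ∀ d, d ∣ 4 * N + 1 → ∀ ζ : ℂ, IsPrimitiveRoot ζ d → IsPrimitiveRoot (ζ ^ 2) d :=
      fun d hd ζ hζ => hζ.pow_of_coprime 2 (hodd.of_dvd_nat hd).coprime_two_left
    have hq2ζ : ∀ ζ : ℂ, SpecializesTo ζ (q ^ 2) (ζ ^ 2) := fun ζ => (hqζ ζ).pow 2
    have hone : ∀ d, d ∣ 4 * N + 1 → 1 < d → ∀ ζ : ℂ, IsPrimitiveRoot ζ d → 1 + ζ ^ 2 ≠ 0 := by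
      intro d hd hd1 ζ hζ h
      have h2 := (hprim d hd ζ hζ)
      have h3 : (ζ ^ 2) ^ 2 = 1 := by
        rw [← neg_eq_of_add_eq_zero_right h]; ring
      have h4 := Nat.le_of_dvd (by norm_num) ((h2.pow_eq_one_iff_dvd 2).mp h3)
      obtain rfl : d = 2 := by omega
      omega
    have hden : ∀ d, d ∣ 4 * N + 1 → 1 < d → ∀ ζ : ℂ, IsPrimitiveRoot ζ d →
        SpecializesTo ζ ((1 - q ^ 2) * (1 - q) ^ 2)⁻¹ ((1 - ζ ^ 2) * (1 - ζ) ^ 2)⁻¹ :=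
      fun d hd hd1 ζ hζ => ((SpecializesTo.one.sub (hq2ζ ζ)).mul
        ((SpecializesTo.one.sub (hqζ ζ)).pow 2)).inv (mul_ne_zero
          (sub_ne_zero.mpr ((hprim d hd ζ hζ).ne_one hd1).symm)
          (pow_ne_zero 2 (sub_ne_zero.mpr (hζ.ne_one hd1).symm)))
    have hq21 : 1 + q ^ 2 ≠ 0 :=
      (SpecializesTo.one.add (hq2ζ _)).ne_zero (hone (4 * N + 1) dvd_rfl (by omega) _
        (Complex.isPrimitiveRoot_exp (4 * N + 1) (by omega)))
    have hW : ∀ ζ : ℂ, ζ ≠ 0 → ∀ k, SpecializesTo ζ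
        (((q ^ 2) ^ (4 * k))⁻¹ + (q ^ 2) ^ (4 * k + 1) - 2 * q)
        (((ζ ^ 2) ^ (4 * k))⁻¹ + (ζ ^ 2) ^ (4 * k + 1) - 2 * ζ) := fun ζ hζ k =>
      ((((hq2ζ ζ).pow _).inv (pow_ne_zero _ (pow_ne_zero _ hζ))).add ((hq2ζ ζ).pow _)).sub
        ((SpecializesTo.ofNat 2).mul (hqζ ζ))
    refine qCong_of_vanishesTo (by omega) (fun ζ hζ => ?_) fun d hdn hd ζ hζ => ?_
    · rw [second_sum_eq q (hqX 2 two_pos) hq0 hq21]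
      refine VanishesTo.mul_specializesTo ?_ (hden _ dvd_rfl (by omega) ζ hζ)
      have hz := hprim _ dvd_rfl ζ hζ
      have h1 := vanishesTo_sum_tail (hq2ζ ζ) hz hM _ _ (hW ζ (hζ.ne_zero (by omega)))
      obtain ⟨h2, h3⟩ := sum_qRatio_approx (hq2ζ ζ) hq2X hz
      have h4 := h2.mul_specializesTo ((SpecializesTo.ofNat 2).mul (hqζ ζ))
      convert (h1.add (h3 hN)).sub h4 using 1
      simp only [mul_sub, Finset.sum_sub_distrib, ← Finset.sum_mul]
      ring
    · rw [second_sum_eq q (hqX 2 two_pos) hq0 hq21]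
      refine VanishesTo.mul_specializesTo ?_ (hden d hdn hd ζ hζ)
      have hz := hprim d hdn ζ hζ
      refine VanishesTo.sub ?_ ((vanishesTo_closed_form (hq2ζ ζ) hz hq2X hdn).mul_specializesTo
        ((((SpecializesTo.ofNat 4).mul (hq2ζ ζ)).div (SpecializesTo.one.add (hq2ζ ζ))
          (hone d hdn hd ζ hζ)).sub ((SpecializesTo.ofNat 2).mul (hqζ ζ))))
      exact vanishesTo_sum (hq2ζ ζ) hz hq2X hM hdn _ _ (hW ζ (hζ.ne_zero (by omega)))
        (fun j r => weight_periodic hz.pow_eq_one _ j r)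
        (fun k m hm hk => weight_reflect ((hz.pow_eq_one_iff_dvd _).mpr hm) _ hk)
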